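/- Let $n,m,r$ be natural numbers and let $f:\mathbb{R}^{n\times m}\to\mathbb{R}$ be twice continuously differentiable. For $\mu>0$, $U\in\mathbb{R}^{n\times r}$, $V\in\mathbb{R}^{m\times r}$ and $W=\begin{bmatrix}U\\V\end{bmatrix}\in\mathbb{R}^{(n+m)\times r}$, put $$\rho(W)=\rho(U,V)=f(UV^{\mathrm T})+\frac{\mu}{4}\,\|U^{\mathrm T}U-V^{\mathrm T}V\|_F^2 .$$ A critical point is a point where the gradient vanishes; $\lambda_{\min}$ denotes the smallest eigenvalue and $\sigma_\ell(\cdot)$ the $\ell$-th largest singular value. (1) For any $\mu>0$, every critical point $W=\begin{bmatrix}U\\V\end{bmatrix}$ of $\rho$ satisfies $U^{\mathrm T}U-V^{\mathrm T}V=0$. (2) Suppose in addition that $f$ is $(2r,4r)$-restricted strongly convex and smooth with constants $\alpha,\beta>0$, that is, $$\alpha\|G\|_F^2\le[\nabla^2f(X)](G,G)\le\beta\|G\|_F^2\quad\text{for all } X,G\in\mathbb{R}^{n\times m}\text{ with } \operatorname{rank}X\le 2r,\ \operatorname{rank}G\le 4r,$$ that $\beta/\alpha\le 1.5$, that $f$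 has a critical point $X^\star$ with $\operatorname{rank}X^\star=r^\star\le r$, and that $0<\mu\le\alpha/16$. Then: (a) $X^\star$ is the unique minimizer of $f$ over $\{X\in\mathbb{R}^{n\times m}:\operatorname{rank}X\le r\}$. (b) $\rho$ has no spurious local minima: every local minimum $W=\begin{bmatrix}U\\V\end{bmatrix}$ of $\rho$ is a global minimum of $\rho$ and satisfies $UV^{\mathrm T}=X^\star$. (c) Every critical point $W$ of $\rho$ that is not a local minimum is a strict saddle, that is, $\lambda_{\min}(\nabla^2\rho(W))<0$. Moreover, with $r^c=\operatorname{rank}W$: - if $r=r^\star$, then $\lambda_{\min}(\nabla^2\rho(W))\le-0.08\,\alpha\,\sigma_r(X^\star)$; - if $r>r^\star$ and $r^c>0$, then $\lambda_{\min}(\nabla^2\rho(W))\le-0.05\,\alpha\,\min\{\sigma_{r^c}^2(W),\,2\sigma_{r^\star}(X^\star)\}$; - if $r^c=0$, then $\lambda_{\min}(\nabla^2\rho(W))\le-0.1\,\alpha\,\sigma_{r^\star}(X^\star)$. (If $r^\star=0$, every critical point of $\rho$ is a global minimum, so (c) is empty and $\sigma_0$ is never needed.) -/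

import Mathlib

open scoped Matrix Matrix.Norms.Frobenius

noncomputable section

namespace LowRankOpt

/-- `z` is a critical point of `F`: the gradient of `F` vanishes at `z`. -/
def IsCritical {E : Type*} [NormedAddCommGroup E] [NormedSpace ℝ E] (F : E → ℝ) (z : E) : Prop :=
  fderiv ℝ F z = 0

/-- The Hessian of `F` at `z` as a bilinear form, `[∇²F(z)](a, b)`. -/
def hessForm {E : Type*} [NormedAddCommGroup E] [NormedSpace ℝ E] (F : E → ℝ) (z a b : E) : ℝ :=
  fderiv ℝ (fderiv ℝ F) z a b

/-- The Hessian of `F` at `Z` as a matrix of second partial derivatives, whose rows and columns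
are indexed by the entries of `Z`. -/
def hessMatrix {ι κ : Type*} [Fintype ι] [Fintype κ] [DecidableEq ι] [DecidableEq κ]
    (F : Matrix ι κ ℝ → ℝ) (Z : Matrix ι κ ℝ) : Matrix (ι × κ) (ι × κ) ℝ :=
  Matrix.of fun p q => hessForm F Z (Matrix.single p.1 p.2 1) (Matrix.single q.1 q.2 1)

/-- The smallest (real) eigenvalue of a square matrix. The spectrum is finite, and it is nonempty
for a symmetric matrix of positive size, so that the infimum is then attained. -/
def lambdaMin {ι : Type*} [Fintype ι] [DecidableEq ι] (H : Matrix ι ι ℝ) : ℝ :=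
  sInf (spectrum ℝ H)

/-- The `ℓ`-th largest singular value `σ_ℓ(A)`, for `ℓ ≥ 1` (the sequence in Mathlib starts at
index `0`). -/
def sigma {ι κ : Type*} [Fintype ι] [Fintype κ] [DecidableEq ι] [DecidableEq κ]
    (ℓ : ℕ) (A : Matrix ι κ ℝ) : ℝ :=
  (Matrix.toEuclideanLin A).singularValues (ℓ - 1)

/-- `(p, q)`-restricted strong convexity and smoothness with constants `α` and `β`
(`‖·‖` is the Frobenius norm). -/
def RestrictedConvexSmooth {n m : ℕ} (p q : ℕ) (α β : ℝ)
    (f : Matrix (Fin n) (Fin m) ℝ → ℝ) : Prop :=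
  ∀ X G : Matrix (Fin n) (Fin m) ℝ, X.rank ≤ p → G.rank ≤ q →
    α * ‖G‖ ^ 2 ≤ hessForm f X G G ∧ hessForm f X G G ≤ β * ‖G‖ ^ 2

/-- `X` solves the problem of minimizing `f` over all matrices of rank at most `r`. -/
def IsLowRankSolution {n m : ℕ} (f : Matrix (Fin n) (Fin m) ℝ → ℝ) (r : ℕ)
    (X : Matrix (Fin n) (Fin m) ℝ) : Prop :=
  X.rank ≤ r ∧ ∀ Y : Matrix (Fin n) (Fin m) ℝ, Y.rank ≤ r → f X ≤ f Y

/-- The regularized factored objective `ρ(W) = f(U Vᵀ) + (μ/4) ‖Uᵀ U - Vᵀ V‖_F²` as a function of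
the stacked variable `W = [U; V]`, where `U` is the upper block `W.toRows₁` and `V` is the lower
block `W.toRows₂`. -/
def rho {n m r : ℕ} (f : Matrix (Fin n) (Fin m) ℝ → ℝ) (μ : ℝ)
    (W : Matrix (Fin n ⊕ Fin m) (Fin r) ℝ) : ℝ :=
  f (W.toRows₁ * W.toRows₂ᵀ) +
    μ / 4 * ‖W.toRows₁ᵀ * W.toRows₁ - W.toRows₂ᵀ * W.toRows₂‖ ^ 2

end LowRankOpt

end

/-!
At a critical point `[U; V]`, put `D = Uᵀ U - Vᵀ V`. Differentiating `ρ` in the direction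
`[U D; -V D]`, along which `U Vᵀ` is stationary, gives `U D = 0` and `V D = 0`, hence `D = 0`. The
gradient `G` of `f` at `X = U Vᵀ` therefore satisfies `Uᵀ G = 0` and `G V = 0`.

Suppose `X ≠ X⋆`. Let `(u, v)` be a top pair of singular vectors of `G`, with singular value `g`,
and let `e` be a least right singular vector of `V`, with singular value `s`. Moving along
`[-u eᵀ; v eᵀ]` keeps `Uᵀ U - Vᵀ V` equal to zero, so only `f` contributes to the curvature of `ρ`,
which is at most `2 (β s² - g)`. Two lower bounds on `g` make this negative:

* `α σ(X⋆) ≤ g`, because `α ‖X - X⋆‖² ≤ -⟪G, X⋆⟫` by restricted strong convexity, while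
  `σ(X⋆) · -⟪G, X⋆⟫ ≤ g ‖X - X⋆‖²` by comparing the row spaces of `X` and `X⋆`;
* `α (α + β) s² ≤ (β - α) g`. Let `P` project onto the row spaces of `X` and `X⋆`. Restricted
  convexity and smoothness put `X⋆` within `(β - α) / (α + β) * ‖X - X⋆‖` of
  `Y = X - 2 / (α + β) • G P`. If `g` were small compared with `s²`, then `X` would be nearly a best
  approximation of `Y` of rank at most `r`, and `X⋆` could not be that close to `Y`.
-/

namespace LowRankOpt

open scoped InnerProductSpace

variable {ι κ η : Type*} [Fintype ι] [Fintype κ] [Fintype η]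

section FrobeniusInner

/-- The Frobenius inner product `⟪A, B⟫ = tr (Aᵀ B)` on real matrices, compatible with the Frobenius
norm. It is scoped because Mathlib keeps matrix norms scoped as well. -/
noncomputable scoped instance frobeniusInnerProductSpace : InnerProductSpace ℝ (Matrix ι κ ℝ) where
  inner A B := (Aᵀ * B).trace
  norm_sq_eq_re_inner A := by
    rw [Matrix.frobenius_norm_def, ← Real.sqrt_eq_rpow, Real.sq_sqrt (by positivity),
      Finset.sum_comm]
    simp [Matrix.trace, Matrix.mul_apply, sq]
  conj_inner_symm A B := by
    rw [← Matrix.trace_transpose]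
    simp
  add_left A B C := by simp [Matrix.add_mul]
  smul_left A B c := by simp

lemma inner_eq_trace (A B : Matrix ι κ ℝ) : ⟪A, B⟫_ℝ = (Aᵀ * B).trace := rfl

lemma inner_eq_sum (A B : Matrix ι κ ℝ) : ⟪A, B⟫_ℝ = ∑ i, ∑ j, A i j * B i j := by
  rw [inner_eq_trace, Finset.sum_comm]
  simp [Matrix.trace, Matrix.mul_apply]

lemma inner_mul_left (A : Matrix ι κ ℝ) (B : Matrix κ η ℝ) (C : Matrix ι η ℝ) :
    ⟪A * B, C⟫_ℝ = ⟪B, Aᵀ * C⟫_ℝ := by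
  simp only [inner_eq_trace, Matrix.transpose_mul, Matrix.mul_assoc]

lemma inner_mul_right (A : Matrix ι κ ℝ) (B : Matrix κ η ℝ) (C : Matrix ι η ℝ) :
    ⟪A * B, C⟫_ℝ = ⟪A, C * Bᵀ⟫_ℝ := by
  rw [inner_eq_trace, inner_eq_trace, Matrix.transpose_mul, Matrix.mul_assoc,
    Matrix.trace_mul_comm, Matrix.mul_assoc]

lemma inner_transpose (A B : Matrix ι κ ℝ) : ⟪Aᵀ, Bᵀ⟫_ℝ = ⟪A, B⟫_ℝ := by
  rw [inner_eq_trace, inner_eq_trace, ← Matrix.transpose_mul, Matrix.trace_transpose,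
    Matrix.trace_mul_comm]

lemma norm_sq_eq_trace (A : Matrix ι κ ℝ) : ‖A‖ ^ 2 = (Aᵀ * A).trace :=
  (real_inner_self_eq_norm_sq A).symm

lemma norm_fromRows_sq (A : Matrix ι η ℝ) (B : Matrix κ η ℝ) :
    ‖Matrix.fromRows A B‖ ^ 2 = ‖A‖ ^ 2 + ‖B‖ ^ 2 := by
  simp only [← real_inner_self_eq_norm_sq, inner_eq_sum, Fintype.sum_sum_type,
    Matrix.fromRows_apply_inl, Matrix.fromRows_apply_inr]

end FrobeniusInner

section Rank

variable {R m n l : Type*} [Field R] [Fintype n]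

lemma rank_add_le (A B : Matrix m n R) : (A + B).rank ≤ A.rank + B.rank := by
  have hrange : LinearMap.range (A + B).mulVecLin ≤
      LinearMap.range A.mulVecLin ⊔ LinearMap.range B.mulVecLin := by
    rintro _ ⟨x, rfl⟩
    rw [Matrix.mulVecLin_add]
    exact Submodule.add_mem_sup ⟨x, rfl⟩ ⟨x, rfl⟩
  exact (Submodule.finrank_mono hrange).trans (Submodule.finrank_add_le_finrank_add_finrank _ _)

lemma rank_pos {A : Matrix m n R} (hA : A ≠ 0) : 0 < A.rank := by
  classical
  rw [Nat.pos_iff_ne_zero, Matrix.rank, Ne, Submodule.finrank_eq_zero, LinearMap.range_eq_bot]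
  exact fun hzero => hA (Matrix.toLin'.map_eq_zero_iff.mp hzero)

lemma rank_smul_le (c : R) (A : Matrix m n R) : (c • A).rank ≤ A.rank := by
  classical
  have hmul : c • A = A * (c • (1 : Matrix n n R)) := by simp
  exact hmul ▸ Matrix.rank_mul_le_left _ _

lemma rank_sub_le (A B : Matrix m n R) : (A - B).rank ≤ A.rank + B.rank := by
  rw [sub_eq_add_neg, ← neg_one_smul R B]
  exact (rank_add_le _ _).trans (Nat.add_le_add_left (rank_smul_le _ _) _)

lemma rank_add_smul_sub_le (A B : Matrix m n R) (t : R) :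
    (A + t • (B - A)).rank ≤ A.rank + B.rank := by
  have hcomb : A + t • (B - A) = (1 - t) • A + t • B := by module
  rw [hcomb]
  exact (rank_add_le _ _).trans (Nat.add_le_add (rank_smul_le _ _) (rank_smul_le _ _))

lemma rank_mul_le_card [Fintype m] (A : Matrix l m R) (B : Matrix m n R) :
    (A * B).rank ≤ Fintype.card m :=
  (Matrix.rank_mul_le_left _ _).trans A.rank_le_card_width

lemma rank_fromRows_le [Finite l] [Finite m] (A : Matrix l n R) (B : Matrix m n R) :
    (Matrix.fromRows A B).rank ≤ A.rank + B.rank := by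
  classical
  cases nonempty_fintype l
  cases nonempty_fintype m
  have hsplit : Matrix.fromRows A B =
      (Matrix.fromRows 1 0 : Matrix (l ⊕ m) l R) * A +
        (Matrix.fromRows 0 1 : Matrix (l ⊕ m) m R) * B := by
    rw [Matrix.fromRows_mul, Matrix.fromRows_mul]
    ext (i | i) j <;> simp
  rw [hsplit]
  exact (rank_add_le _ _).trans
    (Nat.add_le_add (Matrix.rank_mul_le_right _ _) (Matrix.rank_mul_le_right _ _))

end Rank

section Projections

lemma transpose_eq_of_isStarProjection {P : Matrix ι ι ℝ} (hP : IsStarProjection P) : Pᵀ = P :=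
  (Matrix.conjTranspose_eq_transpose_of_trivial P).symm.trans hP.isSelfAdjoint.star_eq

variable {P Q : Matrix ι ι ℝ}

lemma norm_mul_sq_add_norm_mul_one_sub_sq [DecidableEq ι] (hP : IsStarProjection P)
    (A : Matrix κ ι ℝ) :
    ‖A * P‖ ^ 2 + ‖A * (1 - P)‖ ^ 2 = ‖A‖ ^ 2 := by
  have horth : ⟪A * P, A * (1 - P)⟫_ℝ = 0 := by
    rw [inner_mul_right, transpose_eq_of_isStarProjection hP, Matrix.mul_assoc,
      hP.isIdempotentElem.one_sub_mul_self, Matrix.mul_zero, inner_zero_right]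
  have hsplit : A = A * P + A * (1 - P) := by
    rw [← Matrix.mul_add, add_sub_cancel, Matrix.mul_one]
  conv_rhs => rw [hsplit, norm_add_sq_real, horth, mul_zero, add_zero]

lemma norm_mul_le_of_isStarProjection (hP : IsStarProjection P) (A : Matrix κ ι ℝ) :
    ‖A * P‖ ≤ ‖A‖ := by
  classical
  refine le_of_sq_le_sq ?_ (norm_nonneg A)
  rw [← norm_mul_sq_add_norm_mul_one_sub_sq hP A]
  exact le_add_of_nonneg_right (sq_nonneg _)

lemma norm_isStarProjection_mul_le (hP : IsStarProjection P) (A : Matrix ι κ ℝ) :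
    ‖P * A‖ ≤ ‖A‖ := by
  rw [← Matrix.frobenius_norm_transpose, Matrix.transpose_mul, transpose_eq_of_isStarProjection hP,
    ← Matrix.frobenius_norm_transpose A]
  exact norm_mul_le_of_isStarProjection hP Aᵀ

lemma norm_mul_one_sub_sq [DecidableEq ι] (hP : IsStarProjection P) (hQ : IsStarProjection Q) :
    ‖P * (1 - Q)‖ ^ 2 = P.trace - ⟪P, Q⟫_ℝ := by
  have hP' : ‖P‖ ^ 2 = P.trace := by
    rw [norm_sq_eq_trace, transpose_eq_of_isStarProjection hP, hP.isIdempotentElem.eq]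
  have hPQ : ‖P * Q‖ ^ 2 = ⟪P, Q⟫_ℝ := by
    rw [← real_inner_self_eq_norm_sq, inner_mul_right, transpose_eq_of_isStarProjection hQ,
      Matrix.mul_assoc, hQ.isIdempotentElem.eq, real_inner_comm, inner_mul_left,
      transpose_eq_of_isStarProjection hP, hP.isIdempotentElem.eq, real_inner_comm]
  linarith [norm_mul_sq_add_norm_mul_one_sub_sq hQ P]

lemma norm_one_sub_mul_le_of_trace_le [DecidableEq ι] (hP : IsStarProjection P)
    (hQ : IsStarProjection Q) (h : P.trace ≤ Q.trace) : ‖(1 - Q) * P‖ ≤ ‖Q * (1 - P)‖ := by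
  refine le_of_sq_le_sq ?_ (norm_nonneg _)
  rw [← Matrix.frobenius_norm_transpose, Matrix.transpose_mul, transpose_eq_of_isStarProjection hP,
    transpose_eq_of_isStarProjection hQ.one_sub, norm_mul_one_sub_sq hP hQ,
    norm_mul_one_sub_sq hQ hP, real_inner_comm]
  linarith

lemma trace_eq_rank_of_isIdempotentElem (hP : IsIdempotentElem P) : P.trace = P.rank := by
  classical
  have hlin : IsIdempotentElem (Matrix.toLin' P) := by
    rw [IsIdempotentElem, Module.End.mul_eq_comp, ← Matrix.toLin'_mul, hP.eq]
  rw [← Matrix.trace_toLin'_eq, (LinearMap.IsIdempotentElem.isProj_range _ hlin).trace]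
  rfl

lemma exists_transpose_mul_self_mul_eq_transpose (A : Matrix ι κ ℝ) :
    ∃ K : Matrix κ ι ℝ, Aᵀ * A * K = Aᵀ := by
  classical
  have hrange : LinearMap.range (Aᵀ * A).mulVecLin = LinearMap.range Aᵀ.mulVecLin := by
    refine Submodule.eq_of_le_of_finrank_eq ?_ ?_
    · rw [Matrix.mulVecLin_mul]
      exact LinearMap.range_comp_le_range _ _
    · exact (Matrix.rank_transpose_mul_self A).trans (Matrix.rank_transpose A).symm
  have hsolve (i : ι) : ∃ k : κ → ℝ, (Aᵀ * A).mulVecLin k = Aᵀ.mulVecLin (Pi.single i 1) :=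
    LinearMap.mem_range.mp (hrange ▸ LinearMap.mem_range_self _ _)
  choose k hk using hsolve
  refine ⟨(Matrix.of k)ᵀ, ?_⟩
  ext a i
  have hcol := congrFun (hk i) a
  rw [Matrix.mulVecLin_apply, Matrix.mulVecLin_apply, Matrix.mulVec_single_one] at hcol
  exact hcol

lemma exists_isStarProjection_transpose_mul (A : Matrix κ ι ℝ) :
    ∃ K : Matrix κ ι ℝ, IsStarProjection (Aᵀ * K) ∧ A * (Aᵀ * K) = A := by
  classical
  obtain ⟨K, hK⟩ := exists_transpose_mul_self_mul_eq_transpose Aᵀ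
  rw [Matrix.transpose_transpose] at hK
  have hgram : (Aᵀ * K)ᵀ * (Aᵀ * K) = (Aᵀ * K)ᵀ := by
    rw [Matrix.transpose_mul, Matrix.transpose_transpose, Matrix.mul_assoc, ← Matrix.mul_assoc A,
      hK]
  have hsymm : (Aᵀ * K)ᵀ = Aᵀ * K :=
    (hgram ▸ Matrix.isSymm_transpose_mul_self (Aᵀ * K) : (Aᵀ * K)ᵀ.IsSymm).symm
  refine ⟨K, ⟨?_, ?_⟩, ?_⟩
  · rwa [hsymm] at hgram
  · exact (Matrix.conjTranspose_eq_transpose_of_trivial _).trans hsymm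
  · rw [← Matrix.mul_assoc, hK]

lemma exists_isStarProjection_mul_eq_self {κ η : Type*} [Finite κ] [Finite η] (A : Matrix κ ι ℝ)
    (B : Matrix η ι ℝ) :
    ∃ P : Matrix ι ι ℝ, IsStarProjection P ∧ A * P = A ∧ B * P = B ∧ P.rank ≤ A.rank + B.rank := by
  cases nonempty_fintype κ
  cases nonempty_fintype η
  obtain ⟨K, hP, hrows⟩ := exists_isStarProjection_transpose_mul (Matrix.fromRows A B)
  rw [Matrix.fromRows_mul] at hrows
  obtain ⟨hA, hB⟩ := Matrix.fromRows_inj hrows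
  refine ⟨_, hP, hA, hB, ?_⟩
  calc ((Matrix.fromRows A B)ᵀ * K).rank ≤ (Matrix.fromRows A B)ᵀ.rank :=
        Matrix.rank_mul_le_left _ _
    _ = (Matrix.fromRows A B).rank := Matrix.rank_transpose _
    _ ≤ A.rank + B.rank := rank_fromRows_le A B

end Projections

section Spectral

variable [DecidableEq ι] {S : Matrix ι ι ℝ}

lemma inner_transpose_eigenvectorUnitary_mul (hS : S.IsHermitian) (A B : Matrix ι κ ℝ) :
    ⟪(hS.eigenvectorUnitary : Matrix ι ι ℝ)ᵀ * A, (hS.eigenvectorUnitary : Matrix ι ι ℝ)ᵀ * B⟫_ℝ =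
      ⟪A, B⟫_ℝ := by
  have horth : (hS.eigenvectorUnitary : Matrix ι ι ℝ) * (hS.eigenvectorUnitary : Matrix ι ι ℝ)ᵀ =
      1 := Unitary.coe_mul_star_self _
  rw [inner_mul_left, Matrix.transpose_transpose, ← Matrix.mul_assoc, horth, Matrix.one_mul]

lemma norm_sq_eq_sum_eigenvectorUnitary (hS : S.IsHermitian) (Z : Matrix ι κ ℝ) :
    ‖Z‖ ^ 2 = ∑ i, ∑ j, (((hS.eigenvectorUnitary : Matrix ι ι ℝ)ᵀ * Z) i j) ^ 2 := by
  rw [← real_inner_self_eq_norm_sq, ← inner_transpose_eigenvectorUnitary_mul hS, inner_eq_sum]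
  simp only [sq]

lemma transpose_eigenvectorUnitary_mul_mul {κ : Type*} (hS : S.IsHermitian) (Z : Matrix ι κ ℝ) :
    (hS.eigenvectorUnitary : Matrix ι ι ℝ)ᵀ * (S * Z) =
      Matrix.diagonal hS.eigenvalues * ((hS.eigenvectorUnitary : Matrix ι ι ℝ)ᵀ * Z) := by
  have horth : (hS.eigenvectorUnitary : Matrix ι ι ℝ)ᵀ * (hS.eigenvectorUnitary : Matrix ι ι ℝ) =
      1 := Unitary.coe_star_mul_self hS.eigenvectorUnitary
  have hdiag : (hS.eigenvectorUnitary : Matrix ι ι ℝ)ᵀ * S =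
      Matrix.diagonal hS.eigenvalues * (hS.eigenvectorUnitary : Matrix ι ι ℝ)ᵀ := by
    calc (hS.eigenvectorUnitary : Matrix ι ι ℝ)ᵀ * S
      _ = (hS.eigenvectorUnitary : Matrix ι ι ℝ)ᵀ * ((hS.eigenvectorUnitary : Matrix ι ι ℝ) *
          Matrix.diagonal hS.eigenvalues * (hS.eigenvectorUnitary : Matrix ι ι ℝ)ᵀ) :=
        congrArg _ hS.spectral_theorem
      _ = _ := by simp only [← Matrix.mul_assoc, horth, Matrix.one_mul]
  rw [← Matrix.mul_assoc, hdiag, Matrix.mul_assoc]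

lemma inner_mul_self_eq_sum_eigenvalues (hS : S.IsHermitian) (Z : Matrix ι κ ℝ) :
    ⟪Z, S * Z⟫_ℝ =
      ∑ i, ∑ j, hS.eigenvalues i * (((hS.eigenvectorUnitary : Matrix ι ι ℝ)ᵀ * Z) i j) ^ 2 := by
  rw [← inner_transpose_eigenvectorUnitary_mul hS, transpose_eigenvectorUnitary_mul_mul hS,
    inner_eq_sum]
  simp only [Matrix.diagonal_mul]
  congr! 2
  ring

lemma norm_mul_sq_eq_sum_eigenvalues (hS : S.IsHermitian) (Z : Matrix ι κ ℝ) :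
    ‖S * Z‖ ^ 2 =
      ∑ i, ∑ j, (hS.eigenvalues i * ((hS.eigenvectorUnitary : Matrix ι ι ℝ)ᵀ * Z) i j) ^ 2 := by
  simp only [norm_sq_eq_sum_eigenvectorUnitary hS (S * Z), transpose_eigenvectorUnitary_mul_mul hS,
    Matrix.diagonal_mul]

lemma lambdaMin_mul_norm_sq_le (hS : S.IsHermitian) (Z : Matrix ι κ ℝ) :
    lambdaMin S * ‖Z‖ ^ 2 ≤ ⟪Z, S * Z⟫_ℝ := by
  simp only [inner_mul_self_eq_sum_eigenvalues hS, norm_sq_eq_sum_eigenvectorUnitary hS Z,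
    Finset.mul_sum]
  gcongr with i _ j _
  exact csInf_le Matrix.finite_real_spectrum.bddBelow (hS.eigenvalues_mem_spectrum_real i)

lemma exists_eigenvector_lambdaMin [Nonempty ι] (hS : S.IsHermitian) :
    ∃ v : Matrix ι Unit ℝ, ‖v‖ = 1 ∧ S * v = lambdaMin S • v := by
  obtain ⟨i, hi⟩ : lambdaMin S ∈ Set.range hS.eigenvalues := by
    rw [← hS.spectrum_real_eq_range_eigenvalues]
    refine Set.Nonempty.csInf_mem ?_ Matrix.finite_real_spectrum
    exact ⟨_, hS.eigenvalues_mem_spectrum_real (Classical.arbitrary ι)⟩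
  refine ⟨Matrix.replicateCol Unit (hS.eigenvectorBasis i), ?_, ?_⟩
  · rw [Matrix.frobenius_norm_replicateCol]
    exact hS.eigenvectorBasis.norm_eq_one i
  · rw [← hi]
    ext a
    exact congrFun (hS.mulVec_eigenvectorBasis i) a

end Spectral

section SingularValues

/-! Vectors are one-column matrices, so that the Frobenius norm and inner product serve for
vectors and matrices alike. -/

lemma norm_mul_sq_eq_inner (A : Matrix ι κ ℝ) (Z : Matrix κ η ℝ) :
    ‖A * Z‖ ^ 2 = ⟪Z, Aᵀ * A * Z⟫_ℝ := by
  rw [← real_inner_self_eq_norm_sq, inner_mul_left, Matrix.mul_assoc]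

lemma transpose_mul_self_eq_one {v : Matrix ι Unit ℝ} (hv : ‖v‖ = 1) : vᵀ * v = 1 := by
  have htrace : (vᵀ * v).trace = 1 := by rw [← norm_sq_eq_trace, hv, one_pow]
  ext
  simpa [Matrix.trace] using htrace

lemma norm_mul_sq_le_neg_lambdaMin_mul [DecidableEq κ] (A : Matrix ι κ ℝ) (Z : Matrix κ η ℝ) :
    ‖A * Z‖ ^ 2 ≤ -lambdaMin (-(Aᵀ * A)) * ‖Z‖ ^ 2 := by
  have hle := lambdaMin_mul_norm_sq_le (Matrix.isHermitian_conjTranspose_mul_self A).neg Z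
  rw [Matrix.conjTranspose_eq_transpose_of_trivial, Matrix.neg_mul, inner_neg_right,
    ← norm_mul_sq_eq_inner] at hle
  linarith

lemma exists_greatestSingularVectors {A : Matrix ι κ ℝ} (hA : A ≠ 0) :
    ∃ (s : ℝ) (u : Matrix ι Unit ℝ) (v : Matrix κ Unit ℝ), 0 < s ∧ ‖u‖ = 1 ∧ ‖v‖ = 1 ∧
      A * v = s • u ∧ Aᵀ * u = s • v ∧
      ∀ {η : Type*} [Fintype η] (Z : Matrix κ η ℝ), ‖A * Z‖ ≤ s * ‖Z‖ := by
  classical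
  set c := -lambdaMin (-(Aᵀ * A)) with hc
  have hnonempty : Nonempty κ := by
    by_contra! hempty
    exact hA (Subsingleton.elim _ _)
  have hcpos : 0 < c := by
    have hle := norm_mul_sq_le_neg_lambdaMin_mul A (1 : Matrix κ κ ℝ)
    rw [Matrix.mul_one] at hle
    exact pos_of_mul_pos_left ((sq_pos_of_pos (norm_pos_iff.mpr hA)).trans_le hle) (sq_nonneg _)
  obtain ⟨v, hv, hSv⟩ :=
    exists_eigenvector_lambdaMin (Matrix.isHermitian_conjTranspose_mul_self A).neg
  have hgram : Aᵀ * A * v = c • v := by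
    rw [hc, neg_smul, ← neg_eq_iff_eq_neg, ← Matrix.neg_mul]
    exact hSv
  have hs : 0 < √c := Real.sqrt_pos.mpr hcpos
  have hAv : ‖A * v‖ = √c := by
    rw [← sq_eq_sq₀ (norm_nonneg _) hs.le, norm_mul_sq_eq_inner, hgram, real_inner_smul_right,
      real_inner_self_eq_norm_sq, hv, one_pow, mul_one, Real.sq_sqrt hcpos.le]
  refine ⟨√c, (√c)⁻¹ • (A * v), v, hs, ?_, hv, ?_, ?_, fun Z => ?_⟩
  · rw [norm_smul, hAv, Real.norm_of_nonneg (inv_nonneg.mpr hs.le), inv_mul_cancel₀ hs.ne']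
  · rw [smul_inv_smul₀ hs.ne']
  · rw [Matrix.mul_smul, ← Matrix.mul_assoc, hgram, smul_smul, inv_mul_eq_div, Real.div_sqrt]
  · refine le_of_sq_le_sq ?_ (by positivity)
    rw [mul_pow, Real.sq_sqrt hcpos.le]
    exact norm_mul_sq_le_neg_lambdaMin_mul A Z

lemma exists_leastSingularVector [Nonempty κ] (A : Matrix ι κ ℝ) :
    ∃ e : Matrix κ Unit ℝ, ‖e‖ = 1 ∧
      ∀ {η : Type*} [Fintype η] (Z : Matrix κ η ℝ), ‖A * e‖ * ‖Z‖ ≤ ‖A * Z‖ := by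
  classical
  have hS : (Aᵀ * A).IsHermitian := Matrix.isHermitian_conjTranspose_mul_self A
  obtain ⟨e, he, hSe⟩ := exists_eigenvector_lambdaMin hS
  refine ⟨e, he, fun Z => le_of_sq_le_sq ?_ (norm_nonneg _)⟩
  rw [mul_pow, norm_mul_sq_eq_inner, hSe, real_inner_smul_right, real_inner_self_eq_norm_sq, he,
    one_pow, mul_one, norm_mul_sq_eq_inner]
  exact lambdaMin_mul_norm_sq_le hS Z

variable [DecidableEq κ]

lemma finrank_range_toEuclideanLin {ι : Type*} [Finite ι] (A : Matrix ι κ ℝ) :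
    Module.finrank ℝ (LinearMap.range (Matrix.toEuclideanLin A)) = A.rank := by
  cases nonempty_fintype ι
  rw [A.rank_eq_finrank_range_toLin (EuclideanSpace.basisFun ι ℝ).toBasis
    (EuclideanSpace.basisFun κ ℝ).toBasis, Matrix.toEuclideanLin_eq_toLin_orthonormal]

lemma exists_eigenvalues_eq_singularValues_sq {A : Matrix ι κ ℝ} (hS : (Aᵀ * A).IsHermitian)
    (i : κ) : ∃ k, hS.eigenvalues i = (Matrix.toEuclideanLin A).singularValues k ^ 2 := by
  classical
  have hgram : Matrix.toEuclideanLin (Aᵀ * A) =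
      LinearMap.adjoint (Matrix.toEuclideanLin A) ∘ₗ Matrix.toEuclideanLin A := by
    rw [← Matrix.toEuclideanLin_conjTranspose_eq_adjoint,
      Matrix.conjTranspose_eq_transpose_of_trivial]
    exact Matrix.toLpLin_mul _ _ _ _ _
  have hsq {R : EuclideanSpace ℝ κ →ₗ[ℝ] EuclideanSpace ℝ κ} (hR : R.IsSymmetric)
      (h : R = LinearMap.adjoint (Matrix.toEuclideanLin A) ∘ₗ Matrix.toEuclideanLin A)
      (j : Fin (Fintype.card κ)) : hR.eigenvalues finrank_euclideanSpace j =
        (Matrix.toEuclideanLin A).singularValues j ^ 2 := by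
    subst h
    exact (LinearMap.sq_singularValues_fin _ finrank_euclideanSpace j).symm
  rw [Matrix.IsHermitian.eigenvalues, Matrix.IsHermitian.eigenvalues₀, hsq _ hgram]
  exact ⟨_, rfl⟩

variable [DecidableEq ι]

lemma sigma_nonneg (ℓ : ℕ) (A : Matrix ι κ ℝ) : 0 ≤ sigma ℓ A :=
  LinearMap.singularValues_nonneg _ _

lemma sigma_rank_pos {A : Matrix ι κ ℝ} (h : 0 < A.rank) : 0 < sigma A.rank A := by
  rw [sigma, LinearMap.singularValues_pos_iff_lt_finrank_range, finrank_range_toEuclideanLin]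
  exact Nat.sub_one_lt_of_lt h

lemma sigma_rank_sq_le_eigenvalues {A : Matrix ι κ ℝ} (hS : (Aᵀ * A).IsHermitian) {i : κ}
    (hi : hS.eigenvalues i ≠ 0) : sigma A.rank A ^ 2 ≤ hS.eigenvalues i := by
  obtain ⟨k, hk⟩ := exists_eigenvalues_eq_singularValues_sq hS i
  have hpos : 0 < (Matrix.toEuclideanLin A).singularValues k := by
    rw [LinearMap.singularValues_pos_iff_ne_zero]
    rintro hzero
    exact hi (by rw [hk, hzero, zero_pow two_ne_zero])
  rw [LinearMap.singularValues_pos_iff_lt_finrank_range, finrank_range_toEuclideanLin] at hpos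
  rw [hk]
  exact pow_le_pow_left₀ (sigma_nonneg _ _)
    (LinearMap.singularValues_antitone _ (Nat.le_sub_one_of_lt hpos)) 2

lemma sigma_rank_mul_norm_transpose_mul_le (A : Matrix ι κ ℝ) (Z : Matrix ι η ℝ) :
    sigma A.rank A * ‖Aᵀ * Z‖ ≤ ‖A * (Aᵀ * Z)‖ := by
  have hS : (Aᵀ * A).IsHermitian := Matrix.isHermitian_conjTranspose_mul_self A
  obtain ⟨K, hK⟩ := exists_transpose_mul_self_mul_eq_transpose A
  have hrow : Aᵀ * Z = Aᵀ * A * (K * Z) := by rw [← Matrix.mul_assoc, hK]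
  refine le_of_sq_le_sq ?_ (norm_nonneg _)
  rw [hrow, mul_pow, norm_mul_sq_eq_sum_eigenvalues hS, norm_mul_sq_eq_inner,
    inner_mul_self_eq_sum_eigenvalues hS, transpose_eigenvectorUnitary_mul_mul hS]
  simp only [Finset.mul_sum, Matrix.diagonal_mul]
  refine Finset.sum_le_sum fun i _ => Finset.sum_le_sum fun j _ => ?_
  by_cases hi : hS.eigenvalues i = 0
  · simp [hi]
  · gcongr
    exact sigma_rank_sq_le_eigenvalues hS hi

end SingularValues

section Calculus

variable {E E' : Type*} [NormedAddCommGroup E] [NormedSpace ℝ E] [NormedAddCommGroup E']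
  [NormedSpace ℝ E'] {F : E → ℝ} {F' : E' → ℝ}

lemma differentiable_fderiv_of_contDiff_two (hF : ContDiff ℝ 2 F) :
    Differentiable ℝ (fderiv ℝ F) :=
  (hF.fderiv_right (m := 1) (by norm_num)).differentiable one_ne_zero

lemma hessForm_comm (hF : ContDiff ℝ 2 F) (z a b : E) : hessForm F z a b = hessForm F z b a :=
  (hF.contDiffAt.isSymmSndFDerivAt (by simp)).eq a b

lemma hasDerivAt_parabola (a b c : E) (t : ℝ) :
    HasDerivAt (fun t : ℝ => a + t • b + t ^ 2 • c) (b + (2 * t) • c) t := by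
  have hlin : HasDerivAt (fun t : ℝ => t • b) b t := by
    simpa using (hasDerivAt_id t).smul_const b
  have hquad : HasDerivAt (fun t : ℝ => t ^ 2 • c) ((2 * t) • c) t := by
    simpa using (hasDerivAt_pow 2 t).smul_const c
  exact (hlin.const_add a).add hquad

lemma hasDerivAt_comp_parabola (hF : Differentiable ℝ F) (a b c : E) (t : ℝ) :
    HasDerivAt (fun t : ℝ => F (a + t • b + t ^ 2 • c))
      (fderiv ℝ F (a + t • b + t ^ 2 • c) (b + (2 * t) • c)) t :=
  (hF _).hasFDerivAt.comp_hasDerivAt t (hasDerivAt_parabola a b c t)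

lemma deriv_deriv_comp_parabola (hF : ContDiff ℝ 2 F) (a b c : E) :
    deriv (deriv fun t : ℝ => F (a + t • b + t ^ 2 • c)) 0 =
      hessForm F a b b + 2 * fderiv ℝ F a c := by
  have hgrad := (differentiable_fderiv_of_contDiff_two hF _).hasFDerivAt.comp_hasDerivAt 0
    (hasDerivAt_parabola a b c 0)
  have hvel : HasDerivAt (fun t : ℝ => b + (2 * t) • c) ((2 : ℝ) • c) 0 := by
    simpa using ((hasDerivAt_id (0 : ℝ)).const_mul 2).smul_const c |>.const_add b
  rw [funext fun t => (hasDerivAt_comp_parabola (hF.differentiable two_ne_zero) a b c t).deriv]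
  simpa [hessForm] using (hgrad.clm_apply hvel).deriv

lemma deriv_deriv_comp_line (hF : ContDiff ℝ 2 F) (z d : E) :
    deriv (deriv fun t : ℝ => F (z + t • d)) 0 = hessForm F z d d := by
  simpa using deriv_deriv_comp_parabola hF z d 0

lemma hessForm_eq_of_forall_eq_parabola (hF : ContDiff ℝ 2 F) (hF' : ContDiff ℝ 2 F') {z d : E}
    {a b c : E'} {k : ℝ} (h : ∀ t : ℝ, F (z + t • d) = F' (a + t • b + t ^ 2 • c) + k) :
    hessForm F z d d = hessForm F' a b b + 2 * fderiv ℝ F' a c := by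
  rw [← deriv_deriv_comp_line hF, ← deriv_deriv_comp_parabola hF']
  simp only [h, deriv_add_const']

lemma deriv_deriv_nonneg_of_isLocalMin {φ : ℝ → ℝ} {x : ℝ} (hφ : ContinuousAt φ x)
    (hmin : IsLocalMin φ x) : 0 ≤ deriv (deriv φ) x := by
  by_contra! hneg
  have hmax : IsLocalMax φ x := isLocalMax_of_deriv_deriv_neg hneg hmin.deriv_eq_zero hφ
  have hconst : φ =ᶠ[nhds x] fun _ => φ x := by
    filter_upwards [hmin, hmax] with t hle hge using le_antisymm hge hle
  rw [hconst.deriv.deriv_eq] at hneg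
  simp at hneg

lemma hessForm_nonneg_of_isLocalMin (hF : ContDiff ℝ 2 F) {z : E} (hz : IsLocalMin F z) (d : E) :
    0 ≤ hessForm F z d d := by
  rw [← deriv_deriv_comp_line hF]
  have hline : Continuous fun t : ℝ => z + t • d := by fun_prop
  refine deriv_deriv_nonneg_of_isLocalMin (hF.continuous.comp hline).continuousAt ?_
  have hzero : IsLocalMin F (z + (0 : ℝ) • d) := by simpa using hz
  exact hzero.comp_continuous (g := fun t : ℝ => z + t • d) hline.continuousAt

lemma exists_sub_eq_fderiv (hF : Differentiable ℝ F) (y e : E) :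
    ∃ t ∈ Set.Ioo (0 : ℝ) 1, F (y + e) - F y = fderiv ℝ F (y + t • e) e := by
  have hderiv (t : ℝ) : HasDerivAt (fun t : ℝ => F (y + t • e)) (fderiv ℝ F (y + t • e) e) t := by
    simpa using hasDerivAt_comp_parabola hF y e 0 t
  obtain ⟨t, ht, hslope⟩ := exists_hasDerivAt_eq_slope _ _ zero_lt_one
    (fun t _ => (hderiv t).continuousAt.continuousWithinAt) (fun t _ => hderiv t)
  exact ⟨t, ht, by simp [hslope]⟩

lemma exists_fderiv_sub_eq_hessForm (hF : ContDiff ℝ 2 F) (y e b : E) :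
    ∃ t ∈ Set.Ioo (0 : ℝ) 1,
      fderiv ℝ F (y + e) b - fderiv ℝ F y b = hessForm F (y + t • e) e b := by
  have hdiff := differentiable_fderiv_of_contDiff_two hF
  obtain ⟨t, ht, heq⟩ :=
    exists_sub_eq_fderiv (F := fun z => fderiv ℝ F z b) (hdiff.clm_apply (differentiable_const b))
      y e
  refine ⟨t, ht, heq.trans ?_⟩
  rw [fderiv_clm_apply (hdiff _) (differentiableAt_const b)]
  simp [hessForm]

lemma exists_fderiv_eq_hessForm_of_isCritical (hF : ContDiff ℝ 2 F) {z : E} (hz : IsCritical F z)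
    (e b : E) : ∃ t ∈ Set.Ioo (0 : ℝ) 1, fderiv ℝ F (z + e) b = hessForm F (z + t • e) e b := by
  simpa [show fderiv ℝ F z = 0 from hz] using exists_fderiv_sub_eq_hessForm hF z e b

lemma mul_le_fderiv_of_isCritical (hF : ContDiff ℝ 2 F) {z e : E} {k : ℝ} (hz : IsCritical F z)
    (hk : ∀ s : ℝ, k ≤ hessForm F (z + s • e) e e) {t : ℝ} (ht : 0 ≤ t) :
    t * k ≤ fderiv ℝ F (z + t • e) e := by
  obtain ⟨s, -, hs⟩ := exists_fderiv_eq_hessForm_of_isCritical hF hz (t • e) e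
  rw [hs, smul_smul, hessForm, map_smul, smul_apply, smul_eq_mul]
  exact mul_le_mul_of_nonneg_left (hk _) ht

lemma lt_of_isCritical_of_le_hessForm (hF : ContDiff ℝ 2 F) {z e : E} {k : ℝ}
    (hz : IsCritical F z) (hpos : 0 < k) (hk : ∀ s : ℝ, k ≤ hessForm F (z + s • e) e e) :
    F z < F (z + e) := by
  obtain ⟨t, ht, hslope⟩ := exists_sub_eq_fderiv (hF.differentiable two_ne_zero) z e
  linarith [mul_pos ht.1 hpos, mul_le_fderiv_of_isCritical hF hz hk ht.1.le]

end Calculus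

section MatrixCalculus

variable [DecidableEq ι] [DecidableEq κ]

lemma sum_smul_apply_single {M : Type*} [AddCommGroup M] [Module ℝ M]
    (L : Matrix ι κ ℝ →ₗ[ℝ] M) (D : Matrix ι κ ℝ) :
    ∑ p : ι × κ, D p.1 p.2 • L (Matrix.single p.1 p.2 1) = L D := by
  conv_rhs => rw [Matrix.matrix_eq_sum_single D]
  simp only [Fintype.sum_prod_type, map_sum, ← map_smul, Matrix.smul_single, smul_eq_mul, mul_one]

lemma hessMatrix_mul_replicateCol (F : Matrix ι κ ℝ → ℝ) (Z D : Matrix ι κ ℝ) :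
    hessMatrix F Z * (Matrix.replicateCol Unit fun p => D p.1 p.2 : Matrix (ι × κ) Unit ℝ) =
      Matrix.replicateCol Unit fun p => hessForm F Z (Matrix.single p.1 p.2 1) D := by
  ext p u
  rw [Matrix.replicateCol_apply, hessForm, ← ContinuousLinearMap.coe_coe,
    ← sum_smul_apply_single, Matrix.mul_apply]
  exact Finset.sum_congr rfl fun q _ => mul_comm _ _

lemma inner_replicateCol_hessMatrix_mul (F : Matrix ι κ ℝ → ℝ) (Z D : Matrix ι κ ℝ) :
    ⟪(Matrix.replicateCol Unit fun p => D p.1 p.2 : Matrix (ι × κ) Unit ℝ),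
      hessMatrix F Z * (Matrix.replicateCol Unit fun p => D p.1 p.2 : Matrix (ι × κ) Unit ℝ)⟫_ℝ =
        hessForm F Z D D := by
  rw [hessMatrix_mul_replicateCol, inner_eq_sum, hessForm, ← ContinuousLinearMap.flip_apply,
    ← ContinuousLinearMap.coe_coe, ← sum_smul_apply_single]
  simp [hessForm]

lemma lambdaMin_hessMatrix_mul_norm_sq_le {F : Matrix ι κ ℝ → ℝ} (hF : ContDiff ℝ 2 F)
    (Z D : Matrix ι κ ℝ) : lambdaMin (hessMatrix F Z) * ‖D‖ ^ 2 ≤ hessForm F Z D D := by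
  have hsymm : (hessMatrix F Z).IsHermitian := by
    ext p q
    exact hessForm_comm hF _ _ _
  have hnorm : ‖(Matrix.replicateCol Unit fun p => D p.1 p.2 : Matrix (ι × κ) Unit ℝ)‖ ^ 2 =
      ‖D‖ ^ 2 := by
    simp only [← real_inner_self_eq_norm_sq, inner_eq_sum, Fintype.sum_prod_type,
      Matrix.replicateCol_apply, Finset.univ_unique, Finset.sum_singleton]
  rw [← hnorm, ← inner_replicateCol_hessMatrix_mul]
  exact lambdaMin_mul_norm_sq_le hsymm _

end MatrixCalculus

section Rho

lemma contDiff_matrix_mul {E : Type*} [NormedAddCommGroup E] [NormedSpace ℝ E] {N : WithTop ℕ∞}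
    {A : E → Matrix ι κ ℝ} {B : E → Matrix κ η ℝ} (hA : ContDiff ℝ N A) (hB : ContDiff ℝ N B) :
    ContDiff ℝ N fun x => A x * B x := by
  have hbilin : IsBoundedBilinearMap ℝ fun p : Matrix ι κ ℝ × Matrix κ η ℝ => p.1 * p.2 :=
    { add_left := Matrix.add_mul
      smul_left := Matrix.smul_mul
      add_right := Matrix.mul_add
      smul_right := fun c A B => Matrix.mul_smul A c B
      bound := ⟨1, one_pos, fun A B => by simpa using Matrix.frobenius_norm_mul A B⟩ }
  exact hbilin.contDiff.comp₂ hA hB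

lemma contDiff_of_isLinearMap {E E' : Type*} [NormedAddCommGroup E] [NormedSpace ℝ E]
    [FiniteDimensional ℝ E] [NormedAddCommGroup E'] [NormedSpace ℝ E'] {N : WithTop ℕ∞}
    {T : E → E'} (hT : IsLinearMap ℝ T) : ContDiff ℝ N T :=
  (hT.mk' T).toContinuousLinearMap.contDiff

variable {n m r : ℕ} {f : Matrix (Fin n) (Fin m) ℝ → ℝ} {U A : Matrix (Fin n) (Fin r) ℝ}
  {V B : Matrix (Fin m) (Fin r) ℝ} {μ : ℝ}

lemma contDiff_rho {N : WithTop ℕ∞} (hf : ContDiff ℝ N f) (μ : ℝ) :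
    ContDiff ℝ N (rho (r := r) f μ) := by
  have hU : ContDiff ℝ N fun W : Matrix (Fin n ⊕ Fin m) (Fin r) ℝ => W.toRows₁ :=
    contDiff_of_isLinearMap ⟨fun _ _ => rfl, fun _ _ => rfl⟩
  have hUt : ContDiff ℝ N fun W : Matrix (Fin n ⊕ Fin m) (Fin r) ℝ => W.toRows₁ᵀ :=
    contDiff_of_isLinearMap ⟨fun _ _ => rfl, fun _ _ => rfl⟩
  have hV : ContDiff ℝ N fun W : Matrix (Fin n ⊕ Fin m) (Fin r) ℝ => W.toRows₂ :=
    contDiff_of_isLinearMap ⟨fun _ _ => rfl, fun _ _ => rfl⟩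
  have hVt : ContDiff ℝ N fun W : Matrix (Fin n ⊕ Fin m) (Fin r) ℝ => W.toRows₂ᵀ :=
    contDiff_of_isLinearMap ⟨fun _ _ => rfl, fun _ _ => rfl⟩
  exact (hf.comp (contDiff_matrix_mul hU hVt)).add (contDiff_const.mul
    (((contDiff_matrix_mul hUt hU).sub (contDiff_matrix_mul hVt hV)).norm_sq ℝ))

lemma rho_fromRows_add_smul (f : Matrix (Fin n) (Fin m) ℝ → ℝ) (μ : ℝ)
    (U A : Matrix (Fin n) (Fin r) ℝ) (V B : Matrix (Fin m) (Fin r) ℝ) (t : ℝ) :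
    rho f μ (Matrix.fromRows U V + t • Matrix.fromRows A B) =
      f (U * Vᵀ + t • (A * Vᵀ + U * Bᵀ) + t ^ 2 • (A * Bᵀ)) + μ / 4 *
        ‖(Uᵀ * U - Vᵀ * V) + t • (Uᵀ * A + Aᵀ * U - Vᵀ * B - Bᵀ * V) +
          t ^ 2 • (Aᵀ * A - Bᵀ * B)‖ ^ 2 := by
  have hrows : Matrix.fromRows U V + t • Matrix.fromRows A B =
      Matrix.fromRows (U + t • A) (V + t • B) := by
    ext (i | i) j <;> simp
  rw [hrows, rho, Matrix.toRows₁_fromRows, Matrix.toRows₂_fromRows]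
  congr <;>
  · simp only [Matrix.transpose_add, Matrix.transpose_smul, Matrix.add_mul, Matrix.mul_add,
      Matrix.smul_mul, Matrix.mul_smul]
    module

lemma fderiv_rho_fromRows (hf : ContDiff ℝ 1 f) (μ : ℝ) (U A : Matrix (Fin n) (Fin r) ℝ)
    (V B : Matrix (Fin m) (Fin r) ℝ) :
    fderiv ℝ (rho f μ) (Matrix.fromRows U V) (Matrix.fromRows A B) =
      fderiv ℝ f (U * Vᵀ) (A * Vᵀ + U * Bᵀ) +
        μ / 2 * ⟪Uᵀ * U - Vᵀ * V, Uᵀ * A + Aᵀ * U - Vᵀ * B - Bᵀ * V⟫_ℝ := by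
  have hline := hasDerivAt_comp_parabola ((contDiff_rho hf μ).differentiable one_ne_zero)
    (Matrix.fromRows U V) (Matrix.fromRows A B) 0 0
  have hfit := hasDerivAt_comp_parabola (hf.differentiable one_ne_zero)
    (U * Vᵀ) (A * Vᵀ + U * Bᵀ) (A * Bᵀ) 0
  have hreg := (hasDerivAt_parabola (Uᵀ * U - Vᵀ * V) (Uᵀ * A + Aᵀ * U - Vᵀ * B - Bᵀ * V)
    (Aᵀ * A - Bᵀ * B) 0).norm_sq.const_mul (μ / 4)
  simp only [smul_zero, zero_smul, add_zero, mul_zero, zero_pow two_ne_zero,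
    rho_fromRows_add_smul] at hline hfit hreg
  rw [show μ / 2 = μ / 4 * 2 by ring, mul_assoc]
  exact hline.unique (hfit.add hreg)

lemma transpose_mul_self_sub_eq_zero_of_isCritical (hf : ContDiff ℝ 1 f) (hμ : 0 < μ)
    (h : IsCritical (rho f μ) (Matrix.fromRows U V)) : Uᵀ * U - Vᵀ * V = 0 := by
  set D := Uᵀ * U - Vᵀ * V with hD
  have hsymm : Dᵀ = D := by simp [hD]
  have hsq {k : ℕ} (Y : Matrix (Fin k) (Fin r) ℝ) :
      ⟪D, Yᵀ * (Y * D)⟫_ℝ = ‖Y * D‖ ^ 2 ∧ ⟪D, (Y * D)ᵀ * Y⟫_ℝ = ‖Y * D‖ ^ 2 := by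
    have hleft : ⟪D, Yᵀ * (Y * D)⟫_ℝ = ‖Y * D‖ ^ 2 := by
      rw [← inner_mul_left, real_inner_self_eq_norm_sq]
    refine ⟨hleft, ?_⟩
    rw [← inner_transpose, hsymm, Matrix.transpose_mul, Matrix.transpose_transpose, hleft]
  have hfit : U * D * Vᵀ + U * (-(V * D))ᵀ = 0 := by
    simp [hsymm, Matrix.mul_assoc]
  have hreg : ⟪D, Uᵀ * (U * D) + (U * D)ᵀ * U - Vᵀ * -(V * D) - (-(V * D))ᵀ * V⟫_ℝ =
      2 * (‖U * D‖ ^ 2 + ‖V * D‖ ^ 2) := by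
    simp only [Matrix.mul_neg, Matrix.transpose_neg, Matrix.neg_mul, sub_neg_eq_add,
      inner_add_right, hsq]
    ring
  have hzero : 0 = μ / 2 * (2 * (‖U * D‖ ^ 2 + ‖V * D‖ ^ 2)) := by
    refine (DFunLike.congr_fun h.symm _).trans
      ((fderiv_rho_fromRows hf μ U (U * D) V (-(V * D))).trans ?_)
    rw [hfit, ← hD, hreg, map_zero, zero_add]
  have hsum : ‖U * D‖ ^ 2 + ‖V * D‖ ^ 2 = 0 := by
    rcases mul_eq_zero.mp hzero.symm with h' | h' <;> linarith
  have hU : U * D = 0 := norm_eq_zero.mp (pow_eq_zero_iff two_ne_zero |>.mp (by nlinarith))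
  have hV : V * D = 0 := norm_eq_zero.mp (pow_eq_zero_iff two_ne_zero |>.mp (by nlinarith))
  rw [← inner_self_eq_zero (𝕜 := ℝ)]
  nth_rw 2 [hD]
  rw [inner_sub_right, ← inner_mul_left, ← inner_mul_left, hU, hV, inner_zero_left,
    inner_zero_left, sub_zero]

/-- First-order conditions for the factored problem at a balanced pair: `U` and `V` have the same
Gram matrix, and the gradient of `f` at `U Vᵀ` annihilates both factors. -/
structure IsBalancedCritical (f : Matrix (Fin n) (Fin m) ℝ → ℝ) (U : Matrix (Fin n) (Fin r) ℝ)
    (V : Matrix (Fin m) (Fin r) ℝ) : Prop where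
  transpose_mul_self_eq : Uᵀ * U = Vᵀ * V
  transpose_mul_gradient : Uᵀ * gradient f (U * Vᵀ) = 0
  gradient_mul : gradient f (U * Vᵀ) * V = 0

lemma isBalancedCritical_of_isCritical (hf : ContDiff ℝ 1 f) (hμ : 0 < μ)
    (h : IsCritical (rho f μ) (Matrix.fromRows U V)) : IsBalancedCritical f U V := by
  have hbal := transpose_mul_self_sub_eq_zero_of_isCritical hf hμ h
  set G := gradient f (U * Vᵀ)
  have hstat (A : Matrix (Fin n) (Fin r) ℝ) (B : Matrix (Fin m) (Fin r) ℝ) :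
      ⟪G, A * Vᵀ + U * Bᵀ⟫_ℝ = 0 := by
    refine Eq.symm ((DFunLike.congr_fun h.symm _).trans
      ((fderiv_rho_fromRows hf μ U A V B).trans ?_))
    rw [hbal, inner_zero_left, mul_zero, add_zero]
    exact inner_gradient_left.symm
  refine ⟨sub_eq_zero.mp hbal, ?_, ?_⟩
  · have hself := hstat 0 (Uᵀ * G)ᵀ
    rw [Matrix.zero_mul, zero_add, Matrix.transpose_transpose, real_inner_comm,
      inner_mul_left] at hself
    exact inner_self_eq_zero.mp hself
  · have hself := hstat (G * V) 0
    rw [Matrix.transpose_zero, Matrix.mul_zero, add_zero, ← inner_mul_right] at hself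
    exact inner_self_eq_zero.mp hself

lemma hessForm_rho_fromRows (hf : ContDiff ℝ 2 f) (μ : ℝ) (hUA : Uᵀ * A = 0) (hVB : Vᵀ * B = 0)
    (hAB : Aᵀ * A = Bᵀ * B) :
    hessForm (rho f μ) (Matrix.fromRows U V) (Matrix.fromRows A B) (Matrix.fromRows A B) =
      hessForm f (U * Vᵀ) (A * Vᵀ + U * Bᵀ) (A * Vᵀ + U * Bᵀ) +
        2 * ⟪gradient f (U * Vᵀ), A * Bᵀ⟫_ℝ := by
  have hAU : Aᵀ * U = 0 := by simpa using congrArg Matrix.transpose hUA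
  have hBV : Bᵀ * V = 0 := by simpa using congrArg Matrix.transpose hVB
  rw [inner_gradient_left]
  refine hessForm_eq_of_forall_eq_parabola (contDiff_rho hf μ) hf
    (k := μ / 4 * ‖Uᵀ * U - Vᵀ * V‖ ^ 2) fun t => ?_
  rw [rho_fromRows_add_smul, hUA, hAU, hVB, hBV, hAB]
  simp

end Rho

section RestrictedConvexity

lemma abs_le_mul_of_forall_two_mul_le {a b c k : ℝ} (ha : 0 ≤ a) (hb : 0 ≤ b)
    (h : ∀ t : ℝ, 2 * (t * c) ≤ k * (a ^ 2 + t ^ 2 * b ^ 2)) : |c| ≤ k * (a * b) := by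
  have hka : 0 ≤ k * a := by
    rcases ha.eq_or_lt with rfl | ha
    · simp
    · have hzero := h 0
      have hpos : 0 < a ^ 2 := by positivity
      exact mul_nonneg (nonneg_of_mul_nonneg_left (by linarith) hpos) ha.le
  refine abs_le_of_sq_le_sq ?_ (by rw [← mul_assoc]; positivity)
  have hdiscrim : discrim (k * b ^ 2) (-2 * c) (k * a ^ 2) ≤ 0 :=
    discrim_le_zero fun t => by linarith [h t]
  rw [discrim] at hdiscrim
  linarith

variable {n m r p q : ℕ} {f : Matrix (Fin n) (Fin m) ℝ → ℝ} {α β : ℝ}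
  {X Xs : Matrix (Fin n) (Fin m) ℝ}

lemma abs_two_mul_hessForm_sub_le (hf : ContDiff ℝ 2 f) (h : RestrictedConvexSmooth p q α β f)
    {Y A B : Matrix (Fin n) (Fin m) ℝ} (hY : Y.rank ≤ p) (hAB : A.rank + B.rank ≤ q) :
    |2 * hessForm f Y A B - (α + β) * ⟪A, B⟫_ℝ| ≤ (β - α) * (‖A‖ * ‖B‖) := by
  have hrank (t : ℝ) : (A + t • B).rank ≤ q :=
    (rank_add_le _ _).trans ((Nat.add_le_add_left (rank_smul_le _ _) _).trans hAB)
  have hess (t : ℝ) : hessForm f Y (A + t • B) (A + t • B) =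
      hessForm f Y A A + 2 * t * hessForm f Y A B + t ^ 2 * hessForm f Y B B := by
    have hcomm := hessForm_comm hf Y B A
    simp only [hessForm, map_add, map_smul, add_apply,
      smul_apply, smul_eq_mul] at hcomm ⊢
    linear_combination t * hcomm
  have hnorm (t : ℝ) : ‖A + t • B‖ ^ 2 = ‖A‖ ^ 2 + 2 * t * ⟪A, B⟫_ℝ + t ^ 2 * ‖B‖ ^ 2 := by
    rw [norm_add_sq_real, real_inner_smul_right, norm_smul, mul_pow, Real.norm_eq_abs, sq_abs]
    ring
  -- Polarization: smoothness at `A + t • B` against convexity at `A - t • B`.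
  refine abs_le_mul_of_forall_two_mul_le (norm_nonneg A) (norm_nonneg B) fun t => ?_
  have hsmooth := (h Y _ hY (hrank t)).2
  have hconvex := (h Y _ hY (hrank (-t))).1
  rw [hess, hnorm] at hsmooth hconvex
  linarith

lemma mul_norm_sq_sub_le_hessForm (h : RestrictedConvexSmooth p q α β f)
    (hp : Xs.rank + X.rank ≤ p) (hq : Xs.rank + X.rank ≤ q) (s : ℝ) :
    α * ‖X - Xs‖ ^ 2 ≤ hessForm f (Xs + s • (X - Xs)) (X - Xs) (X - Xs) :=
  (h _ _ ((rank_add_smul_sub_le _ _ _).trans hp)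
    ((rank_sub_le _ _).trans ((Nat.add_comm _ _).trans_le hq))).1

lemma mul_norm_sq_sub_le_inner_gradient (hf : ContDiff ℝ 2 f)
    (h : RestrictedConvexSmooth p q α β f) (hXs : IsCritical f Xs)
    (hp : Xs.rank + X.rank ≤ p) (hq : Xs.rank + X.rank ≤ q) :
    α * ‖X - Xs‖ ^ 2 ≤ ⟪gradient f X, X - Xs⟫_ℝ := by
  have hone := mul_le_fderiv_of_isCritical hf hXs (mul_norm_sq_sub_le_hessForm h hp hq) zero_le_one
  rw [one_mul, one_smul, add_sub_cancel] at hone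
  exact hone.trans_eq inner_gradient_left.symm

lemma abs_two_mul_inner_gradient_sub_le (hf : ContDiff ℝ 2 f)
    (h : RestrictedConvexSmooth p q α β f) (hXs : IsCritical f Xs)
    (hp : Xs.rank + X.rank ≤ p) {B : Matrix (Fin n) (Fin m) ℝ}
    (hq : (X - Xs).rank + B.rank ≤ q) :
    |2 * ⟪gradient f X, B⟫_ℝ - (α + β) * ⟪X - Xs, B⟫_ℝ| ≤ (β - α) * (‖X - Xs‖ * ‖B‖) := by
  obtain ⟨t, -, ht⟩ := exists_fderiv_eq_hessForm_of_isCritical hf hXs (X - Xs) B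
  rw [add_sub_cancel] at ht
  rw [inner_gradient_left.trans ht]
  exact abs_two_mul_hessForm_sub_le hf h ((rank_add_smul_sub_le _ _ _).trans hp) hq

lemma lt_of_ne_of_isCritical (hf : ContDiff ℝ 2 f) (hα : 0 < α)
    (h : RestrictedConvexSmooth p q α β f) (hXs : IsCritical f Xs)
    (hp : Xs.rank + X.rank ≤ p) (hq : Xs.rank + X.rank ≤ q) (hne : X ≠ Xs) : f Xs < f X := by
  have hdist : 0 < ‖X - Xs‖ := norm_pos_iff.mpr (sub_ne_zero.mpr hne)
  simpa using lt_of_isCritical_of_le_hessForm hf hXs (by positivity)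
    (mul_norm_sq_sub_le_hessForm h hp hq)

lemma isLowRankSolution_iff_eq (hf : ContDiff ℝ 2 f) (hα : 0 < α)
    (h : RestrictedConvexSmooth p q α β f) (hp : 2 * r ≤ p) (hq : 2 * r ≤ q)
    (hcrit : IsCritical f Xs) (hXs : Xs.rank ≤ r) : IsLowRankSolution f r X ↔ X = Xs := by
  have hlt {Y : Matrix (Fin n) (Fin m) ℝ} (hY : Y.rank ≤ r) (hne : Y ≠ Xs) : f Xs < f Y :=
    lt_of_ne_of_isCritical hf hα h hcrit (by omega) (by omega) hne
  constructor
  · rintro ⟨hX, hmin⟩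
    by_contra hne
    exact (hlt hX hne).not_ge (hmin Xs hXs)
  · rintro rfl
    refine ⟨hXs, fun Y hY => ?_⟩
    rcases eq_or_ne Y X with rfl | hne
    exacts [le_rfl, (hlt hY hne).le]

end RestrictedConvexity

section Approximation

lemma norm_mul_one_sub_sq_add_norm_mul_one_sub_sq_le [DecidableEq κ] {X G A : Matrix ι κ ℝ}
    {R : Matrix κ κ ℝ} (hR : IsStarProjection R) (hXG : Xᵀ * G = 0) (hAR : A * R = A) :
    ‖X * (1 - R)‖ ^ 2 + ‖G * (1 - R)‖ ^ 2 ≤ ‖A - X - G‖ ^ 2 := by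
  have horth : ⟪X * (1 - R), G * (1 - R)⟫_ℝ = 0 := by
    rw [inner_mul_left, ← Matrix.mul_assoc, hXG, Matrix.zero_mul, inner_zero_right]
  have hcut : (A - X - G) * (1 - R) = -(X * (1 - R) + G * (1 - R)) := by
    rw [Matrix.sub_mul, Matrix.sub_mul, Matrix.mul_sub A, hAR, Matrix.mul_one]
    abel
  calc ‖X * (1 - R)‖ ^ 2 + ‖G * (1 - R)‖ ^ 2 = ‖(A - X - G) * (1 - R)‖ ^ 2 := by
        rw [hcut, norm_neg, norm_add_sq_real, horth, mul_zero, add_zero]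
    _ ≤ ‖A - X - G‖ ^ 2 := by
        gcongr
        exact norm_mul_le_of_isStarProjection hR.one_sub _

-- An Eckart-Young estimate: when `c = 1`, `X` is a best low-rank approximation of `X + G`.
lemma norm_le_mul_norm_sub_sub [DecidableEq κ] {X G A : Matrix ι κ ℝ} {Q : Matrix κ κ ℝ}
    {k c : ℝ} (hQ : IsStarProjection Q) (hXG : Xᵀ * G = 0) (hGQ : G * Q = 0)
    (hA : (A.rank : ℝ) ≤ Q.trace) (hk : 0 ≤ k) (hc : 1 ≤ c)
    (hX : ∀ Z : Matrix κ κ ℝ, k * ‖Q * Z‖ ≤ ‖X * Z‖)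
    (hG : ∀ Z : Matrix κ κ ℝ, ‖G * Z‖ ≤ c * k * ‖Z‖) : ‖G‖ ≤ c * ‖A - X - G‖ := by
  obtain ⟨K, hR, hAR⟩ := exists_isStarProjection_transpose_mul A
  have hrank : (Aᵀ * K).rank ≤ A.rank :=
    (Matrix.rank_mul_le_left _ _).trans A.rank_transpose.le
  generalize Aᵀ * K = R at hR hAR hrank
  have htrace : R.trace ≤ Q.trace := by
    rw [trace_eq_rank_of_isIdempotentElem hR.isIdempotentElem]
    exact (Nat.cast_le.mpr hrank).trans hA
  have hinside : ‖G * R‖ ≤ c * ‖X * (1 - R)‖ :=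
    calc ‖G * R‖ = ‖G * ((1 - Q) * R)‖ := by
          rw [← Matrix.mul_assoc, Matrix.mul_sub, hGQ, Matrix.mul_one, sub_zero]
      _ ≤ c * k * ‖(1 - Q) * R‖ := hG _
      _ ≤ c * k * ‖Q * (1 - R)‖ := by
          gcongr
          exact norm_one_sub_mul_le_of_trace_le hR hQ htrace
      _ ≤ c * ‖X * (1 - R)‖ := by
          rw [mul_assoc]
          gcongr
          exact hX _
  refine le_of_sq_le_sq ?_ (by positivity)
  calc ‖G‖ ^ 2 = ‖G * R‖ ^ 2 + ‖G * (1 - R)‖ ^ 2 :=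
        (norm_mul_sq_add_norm_mul_one_sub_sq hR G).symm
    _ ≤ (c * ‖X * (1 - R)‖) ^ 2 + c ^ 2 * ‖G * (1 - R)‖ ^ 2 := by
        gcongr
        exact le_mul_of_one_le_left (sq_nonneg _) (one_le_pow₀ hc)
    _ = c ^ 2 * (‖X * (1 - R)‖ ^ 2 + ‖G * (1 - R)‖ ^ 2) := by ring
    _ ≤ c ^ 2 * ‖A - X - G‖ ^ 2 := by
        gcongr
        exact norm_mul_one_sub_sq_add_norm_mul_one_sub_sq_le hR hXG hAR
    _ = (c * ‖A - X - G‖) ^ 2 := (mul_pow _ _ _).symm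

lemma le_add_one_mul_of_norm_sub_le [DecidableEq κ] {X G A : Matrix ι κ ℝ} {Q : Matrix κ κ ℝ}
    {k c a b : ℝ} (hQ : IsStarProjection Q) (hXG : Xᵀ * G = 0) (hGQ : G * Q = 0)
    (hA : (A.rank : ℝ) ≤ Q.trace) (hk : 0 ≤ k) (hc : 1 ≤ c) (ha : 0 ≤ a) (hne : X ≠ A)
    (hX : ∀ Z : Matrix κ κ ℝ, k * ‖Q * Z‖ ≤ ‖X * Z‖)
    (hG : ∀ Z : Matrix κ κ ℝ, ‖G * Z‖ ≤ c * (a * k) * ‖Z‖)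
    (hclose : ‖G - a • (X - A)‖ ≤ b * ‖X - A‖) : a ≤ (c + 1) * b := by
  have hnorm : ‖G‖ ≤ c * ‖G - a • (X - A)‖ := by
    have hneg : ‖-G‖ ≤ c * ‖a • A - a • X - -G‖ := by
      refine norm_le_mul_norm_sub_sub (k := a * k) hQ ?_ ?_ ?_ (by positivity) hc ?_ ?_
      · rw [Matrix.transpose_smul, Matrix.smul_mul, Matrix.mul_neg, hXG, neg_zero, smul_zero]
      · rw [Matrix.neg_mul, hGQ, neg_zero]
      · exact (Nat.cast_le.mpr (rank_smul_le a A)).trans hA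
      · intro Z
        rw [Matrix.smul_mul, norm_smul, Real.norm_of_nonneg ha, mul_assoc]
        exact mul_le_mul_of_nonneg_left (hX Z) ha
      · intro Z
        rw [Matrix.neg_mul, norm_neg]
        exact hG Z
    rwa [norm_neg, show a • A - a • X - -G = G - a • (X - A) by module] at hneg
  refine le_of_mul_le_mul_right ?_ (norm_pos_iff.mpr (sub_ne_zero.mpr hne))
  calc a * ‖X - A‖ = ‖G - (G - a • (X - A))‖ := by
        rw [sub_sub_cancel, norm_smul, Real.norm_of_nonneg ha]
    _ ≤ ‖G‖ + ‖G - a • (X - A)‖ := norm_sub_le _ _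
    _ ≤ (c + 1) * ‖G - a • (X - A)‖ := by linarith
    _ ≤ (c + 1) * (b * ‖X - A‖) := by gcongr
    _ = (c + 1) * b * ‖X - A‖ := (mul_assoc _ _ _).symm

lemma exists_isStarProjection_mul_of_forall_mul_norm_le.{u} {ι κ : Type u} [Fintype ι]
    [Fintype κ] {V : Matrix ι κ ℝ} {s : ℝ} (hs : 0 < s)
    (hV : ∀ {η : Type u} [Fintype η] (Z : Matrix κ η ℝ), s * ‖Z‖ ≤ ‖V * Z‖) :
    ∃ L : Matrix κ ι ℝ, IsStarProjection (V * L) ∧ (V * L).trace = Fintype.card κ ∧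
      ∀ {η : Type u} [Fintype η] (Z : Matrix ι η ℝ), s * ‖V * L * Z‖ ≤ ‖Vᵀ * Z‖ := by
  classical
  obtain ⟨L, hQ, hfix⟩ := exists_isStarProjection_transpose_mul Vᵀ
  rw [Matrix.transpose_transpose] at hQ hfix
  have hVLV : V * L * V = V := by
    rw [← Matrix.transpose_inj, Matrix.transpose_mul, transpose_eq_of_isStarProjection hQ, hfix]
  have hLV : L * V = 1 := by
    have hle := hV (L * V - 1)
    rw [Matrix.mul_sub, ← Matrix.mul_assoc, hVLV, Matrix.mul_one, sub_self, norm_zero] at hle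
    exact sub_eq_zero.mp (norm_le_zero_iff.mp (nonpos_of_mul_nonpos_right hle hs))
  refine ⟨L, hQ, ?_, fun {η} _ Z => ?_⟩
  · rw [Matrix.trace_mul_comm, hLV, Matrix.trace_one]
  · rcases (norm_nonneg (V * L * Z)).eq_or_lt with hzero | hpos
    · rw [← hzero, mul_zero]
      exact norm_nonneg _
    · refine le_of_mul_le_mul_right ?_ hpos
      have hsq : ‖V * L * Z‖ ^ 2 = ⟪L * Z, Vᵀ * Z⟫_ℝ := by
        rw [norm_mul_sq_eq_inner, transpose_eq_of_isStarProjection hQ, hQ.isIdempotentElem.eq,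
          real_inner_comm, Matrix.mul_assoc, inner_mul_left]
      calc s * ‖V * L * Z‖ * ‖V * L * Z‖ = s * ⟪L * Z, Vᵀ * Z⟫_ℝ := by rw [← hsq]; ring
        _ ≤ s * (‖L * Z‖ * ‖Vᵀ * Z‖) := by
            gcongr
            exact real_inner_le_norm _ _
        _ = s * ‖L * Z‖ * ‖Vᵀ * Z‖ := (mul_assoc _ _ _).symm
        _ ≤ ‖V * L * Z‖ * ‖Vᵀ * Z‖ := by
            rw [Matrix.mul_assoc]
            gcongr
            exact hV _
        _ = ‖Vᵀ * Z‖ * ‖V * L * Z‖ := mul_comm _ _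

end Approximation

section GradientBound

variable {n m r p q : ℕ} {f : Matrix (Fin n) (Fin m) ℝ → ℝ} {α β : ℝ}
  {X Xs : Matrix (Fin n) (Fin m) ℝ}

lemma sub_mul_norm_nonneg (h : RestrictedConvexSmooth p q α β f)
    {G : Matrix (Fin n) (Fin m) ℝ} (hG : G.rank ≤ q) : 0 ≤ (β - α) * ‖G‖ := by
  rcases (norm_nonneg G).eq_or_lt with hzero | hpos
  · rw [← hzero, mul_zero]
  · obtain ⟨hconvex, hsmooth⟩ := h 0 G (by simp) hG
    have hle : α ≤ β := le_of_mul_le_mul_right (hconvex.trans hsmooth) (by positivity)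
    exact mul_nonneg (sub_nonneg.mpr hle) hpos.le

lemma norm_two_smul_gradient_mul_sub_le (hf : ContDiff ℝ 2 f)
    (h : RestrictedConvexSmooth p q α β f) (hXs : IsCritical f Xs)
    (hp : Xs.rank + X.rank ≤ p) {P : Matrix (Fin m) (Fin m) ℝ} (hP : IsStarProjection P)
    (hXP : (X - Xs) * P = X - Xs) (hq : (X - Xs).rank + P.rank ≤ q) :
    ‖(2 : ℝ) • (gradient f X * P) - (α + β) • (X - Xs)‖ ≤ (β - α) * ‖X - Xs‖ := by
  set B := (2 : ℝ) • (gradient f X * P) - (α + β) • (X - Xs) with hB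
  have hBP : B * P = B := by
    rw [hB, Matrix.sub_mul, Matrix.smul_mul, Matrix.smul_mul, hXP, Matrix.mul_assoc,
      hP.isIdempotentElem.eq]
  have hrank : B.rank ≤ P.rank := hBP ▸ Matrix.rank_mul_le_right B P
  have hself : ‖B‖ ^ 2 = 2 * ⟪gradient f X, B⟫_ℝ - (α + β) * ⟪X - Xs, B⟫_ℝ := by
    rw [← real_inner_self_eq_norm_sq]
    nth_rw 1 [hB]
    rw [inner_sub_left, real_inner_smul_left, real_inner_smul_left, inner_mul_right,
      transpose_eq_of_isStarProjection hP, hBP]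
  rcases (norm_nonneg B).eq_or_lt with hzero | hpos
  · rw [← hzero]
    exact sub_mul_norm_nonneg h (by omega)
  · refine le_of_mul_le_mul_right ?_ hpos
    rw [← sq, mul_assoc, hself]
    exact (le_abs_self _).trans
      (abs_two_mul_inner_gradient_sub_le hf h hXs hp (by omega))

lemma norm_mul_eq_norm_mul {U : Matrix ι η ℝ} {V : Matrix κ η ℝ}
    {θ : Type*} [Fintype θ] (hUV : Uᵀ * U = Vᵀ * V) (Z : Matrix η θ ℝ) :
    ‖U * Z‖ = ‖V * Z‖ := by
  rw [← sq_eq_sq₀ (norm_nonneg _) (norm_nonneg _), norm_mul_sq_eq_inner, norm_mul_sq_eq_inner, hUV]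

variable {U : Matrix (Fin n) (Fin r) ℝ} {V : Matrix (Fin m) (Fin r) ℝ} {s g : ℝ}

lemma add_le_add_one_mul_sub (hf : ContDiff ℝ 2 f)
    (h : RestrictedConvexSmooth (2 * r) (4 * r) α β f) (hαβ : 0 ≤ α + β)
    (hXs : IsCritical f Xs) (hrank : Xs.rank ≤ r) (hUV : IsBalancedCritical f U V)
    (hne : U * Vᵀ ≠ Xs) (hs : 0 < s) (hg : 0 ≤ g)
    (hV : ∀ {η : Type} [Fintype η] (Z : Matrix (Fin r) η ℝ), s * ‖Z‖ ≤ ‖V * Z‖)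
    (hG : ∀ {η : Type} [Fintype η] (Z : Matrix (Fin m) η ℝ),
      ‖gradient f (U * Vᵀ) * Z‖ ≤ g * ‖Z‖)
    {c : ℝ} (hc : 1 ≤ c) (hgc : 2 * g ≤ c * ((α + β) * s ^ 2)) :
    α + β ≤ (c + 1) * (β - α) := by
  set G := gradient f (U * Vᵀ)
  obtain ⟨L, hQ, htrace, hVL⟩ := exists_isStarProjection_mul_of_forall_mul_norm_le hs hV
  obtain ⟨P, hP, hVP, hXsP, hPrank⟩ := exists_isStarProjection_mul_eq_self Vᵀ Xs
  have hPV : P * V = V := by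
    rw [← Matrix.transpose_inj, Matrix.transpose_mul, transpose_eq_of_isStarProjection hP, hVP]
  have hX : (U * Vᵀ).rank ≤ r := by simpa using rank_mul_le_card U Vᵀ
  have hVrank : Vᵀ.rank ≤ r := by simpa using Vᵀ.rank_le_card_height
  have hE := rank_sub_le (U * Vᵀ) Xs
  refine le_add_one_mul_of_norm_sub_le (X := U * Vᵀ) (G := (2 : ℝ) • (G * P)) (k := s ^ 2)
    hQ ?_ ?_ ?_ (sq_nonneg s) hc hαβ hne ?_ ?_
    (norm_two_smul_gradient_mul_sub_le hf h hXs (by omega) hP ?_ (by omega))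
  · rw [Matrix.transpose_mul, Matrix.mul_smul, Matrix.mul_assoc, ← Matrix.mul_assoc Uᵀ,
      hUV.transpose_mul_gradient, Matrix.zero_mul, Matrix.mul_zero, smul_zero]
  · rw [Matrix.smul_mul, Matrix.mul_assoc, ← Matrix.mul_assoc P, hPV, ← Matrix.mul_assoc,
      hUV.gradient_mul, Matrix.zero_mul, smul_zero]
  · rw [htrace, Fintype.card_fin]
    exact Nat.cast_le.mpr hrank
  · intro Z
    rw [Matrix.mul_assoc U, norm_mul_eq_norm_mul hUV.transpose_mul_self_eq, sq,
      mul_assoc]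
    exact (mul_le_mul_of_nonneg_left (hVL Z) hs.le).trans (hV _)
  · intro Z
    calc ‖(2 : ℝ) • (G * P) * Z‖ = 2 * ‖G * (P * Z)‖ := by
          rw [Matrix.smul_mul, norm_smul, Real.norm_two, Matrix.mul_assoc]
      _ ≤ 2 * (g * ‖Z‖) := by
          gcongr
          exact (hG _).trans (mul_le_mul_of_nonneg_left
            (norm_isStarProjection_mul_le hP Z) hg)
      _ ≤ c * ((α + β) * s ^ 2) * ‖Z‖ := by
          rw [← mul_assoc]
          gcongr
  · rw [Matrix.sub_mul, Matrix.mul_assoc, hVP, hXsP]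

lemma mul_add_mul_sq_le_mul_sub (hf : ContDiff ℝ 2 f)
    (h : RestrictedConvexSmooth (2 * r) (4 * r) α β f) (hα : 0 < α) (hle : α ≤ β)
    (hlt : β < 3 * α) (hXs : IsCritical f Xs) (hrank : Xs.rank ≤ r) (hUV : IsBalancedCritical f U V)
    (hne : U * Vᵀ ≠ Xs) (hs : 0 ≤ s) (hg : 0 ≤ g)
    (hV : ∀ {η : Type} [Fintype η] (Z : Matrix (Fin r) η ℝ), s * ‖Z‖ ≤ ‖V * Z‖)
    (hG : ∀ {η : Type} [Fintype η] (Z : Matrix (Fin m) η ℝ),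
      ‖gradient f (U * Vᵀ) * Z‖ ≤ g * ‖Z‖) :
    α * (α + β) * s ^ 2 ≤ g * (β - α) := by
  rcases hs.eq_or_lt with rfl | hs
  · simpa using mul_nonneg hg (sub_nonneg.mpr hle)
  have hpos : 0 < (α + β) * s ^ 2 := by
    have hαβ : 0 < α + β := by linarith
    positivity
  have hc := add_le_add_one_mul_sub hf h (by linarith) hXs hrank hUV hne hs hg hV hG
    (le_max_left 1 (2 * g / ((α + β) * s ^ 2)))
    ((div_le_iff₀ hpos).mp (le_max_right _ _))
  rcases max_choice 1 (2 * g / ((α + β) * s ^ 2)) with hmax | hmax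
  · rw [hmax] at hc
    linarith
  · rw [hmax] at hc
    have hratio : 2 * α ≤ 2 * g * (β - α) / ((α + β) * s ^ 2) := by
      rw [mul_div_right_comm]
      linarith
    rw [le_div_iff₀ hpos] at hratio
    linarith

end GradientBound

section NegativeCurvature

lemma sigma_mul_neg_inner_le [DecidableEq ι] [DecidableEq κ] {A X G : Matrix ι κ ℝ} {g : ℝ}
    (hXG : Xᵀ * G = 0) (hGX : G * Xᵀ = 0) (hG : ∀ Z : Matrix κ κ ℝ, ‖G * Z‖ ≤ g * ‖Z‖)
    (hg : 0 ≤ g) : sigma A.rank A * -⟪G, A⟫_ℝ ≤ g * ‖X - A‖ ^ 2 := by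
  obtain ⟨K, hR, hAR⟩ := exists_isStarProjection_transpose_mul A
  obtain ⟨L, hQ, hXQ⟩ := exists_isStarProjection_transpose_mul X
  have hsigma := sigma_rank_mul_norm_transpose_mul_le A (K * (1 - Xᵀ * L))
  have hGQ : G * (Xᵀ * L) = 0 := by rw [← Matrix.mul_assoc, hGX, Matrix.zero_mul]
  rw [← Matrix.mul_assoc, ← Matrix.mul_assoc] at hsigma
  generalize Aᵀ * K = R at hR hAR hsigma
  generalize Xᵀ * L = Q at hQ hXQ hGQ hsigma
  have hinner : -⟪G, A⟫_ℝ ≤ g * ‖R * (1 - Q)‖ * ‖X - A‖ :=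
    calc -⟪G, A⟫_ℝ = ⟪G * ((1 - Q) * R), X - A⟫_ℝ := by
          have hX : ⟪G * R, X⟫_ℝ = 0 := by
            rw [real_inner_comm, inner_eq_trace, ← Matrix.mul_assoc, hXG, Matrix.zero_mul,
              Matrix.trace_zero]
          rw [← Matrix.mul_assoc, Matrix.mul_sub, hGQ, Matrix.mul_one, sub_zero, inner_sub_right,
            hX, inner_mul_right, transpose_eq_of_isStarProjection hR, hAR, zero_sub]
      _ ≤ ‖G * ((1 - Q) * R)‖ * ‖X - A‖ := real_inner_le_norm _ _
      _ ≤ g * ‖(1 - Q) * R‖ * ‖X - A‖ := by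
          gcongr
          exact hG _
      _ = g * ‖R * (1 - Q)‖ * ‖X - A‖ := by
          rw [← Matrix.frobenius_norm_transpose, Matrix.transpose_mul,
            transpose_eq_of_isStarProjection hR, transpose_eq_of_isStarProjection hQ.one_sub]
  have hmiss : sigma A.rank A * ‖R * (1 - Q)‖ ≤ ‖X - A‖ :=
    calc sigma A.rank A * ‖R * (1 - Q)‖ ≤ ‖A * (1 - Q)‖ := by rwa [hAR] at hsigma
      _ = ‖(X - A) * (1 - Q)‖ := by
          rw [Matrix.sub_mul, Matrix.mul_sub X, hXQ, Matrix.mul_one, sub_self, zero_sub, norm_neg]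
      _ ≤ ‖X - A‖ := norm_mul_le_of_isStarProjection hQ.one_sub _
  calc sigma A.rank A * -⟪G, A⟫_ℝ ≤ sigma A.rank A * (g * ‖R * (1 - Q)‖ * ‖X - A‖) :=
        mul_le_mul_of_nonneg_left hinner (sigma_nonneg _ _)
    _ = g * (sigma A.rank A * ‖R * (1 - Q)‖ * ‖X - A‖) := by ring
    _ ≤ g * (‖X - A‖ * ‖X - A‖) := by gcongr
    _ = g * ‖X - A‖ ^ 2 := by rw [sq]

lemma norm_mul_transpose {a : Matrix ι κ ℝ} {b : Matrix η κ ℝ} [DecidableEq κ]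
    (hb : bᵀ * b = 1) : ‖a * bᵀ‖ = ‖a‖ := by
  rw [← sq_eq_sq₀ (norm_nonneg _) (norm_nonneg _), ← real_inner_self_eq_norm_sq, inner_mul_right,
    Matrix.transpose_transpose, Matrix.mul_assoc, hb, Matrix.mul_one, real_inner_self_eq_norm_sq]

lemma norm_mul_transpose_add_sq {u : Matrix ι κ ℝ} {v : Matrix η κ ℝ} [DecidableEq κ]
    {a : Matrix η κ ℝ} {b : Matrix ι κ ℝ} (hu : uᵀ * u = 1) (hv : vᵀ * v = 1)
    (hav : aᵀ * v = 0) : ‖u * aᵀ + b * vᵀ‖ ^ 2 = ‖a‖ ^ 2 + ‖b‖ ^ 2 := by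
  have horth : ⟪u * aᵀ, b * vᵀ⟫_ℝ = 0 := by
    rw [real_inner_comm, inner_mul_right, Matrix.transpose_transpose, Matrix.mul_assoc, hav,
      Matrix.mul_zero, inner_zero_right]
  rw [norm_add_sq_real, horth, norm_mul_transpose hv, ← Matrix.frobenius_norm_transpose,
    Matrix.transpose_mul, Matrix.transpose_transpose, norm_mul_transpose hu]
  ring

variable {n m r p q : ℕ} {f : Matrix (Fin n) (Fin m) ℝ → ℝ} {α β : ℝ}
  {U : Matrix (Fin n) (Fin r) ℝ} {V : Matrix (Fin m) (Fin r) ℝ} {μ : ℝ}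

lemma hessForm_rho_fromRows_mul_transpose_le (hf : ContDiff ℝ 2 f)
    (h : RestrictedConvexSmooth p q α β f) (μ : ℝ) (hp : (U * Vᵀ).rank ≤ p) (hq : 2 ≤ q)
    (hUV : Uᵀ * U = Vᵀ * V) {u : Matrix (Fin n) Unit ℝ} {v : Matrix (Fin m) Unit ℝ}
    {e : Matrix (Fin r) Unit ℝ} (hu : uᵀ * u = 1) (hv : vᵀ * v = 1) (he : eᵀ * e = 1)
    (hUu : Uᵀ * u = 0) (hVv : Vᵀ * v = 0) :
    hessForm (rho f μ) (Matrix.fromRows U V) (Matrix.fromRows (u * eᵀ) (v * eᵀ))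
        (Matrix.fromRows (u * eᵀ) (v * eᵀ)) ≤
      2 * (β * ‖V * e‖ ^ 2 + ⟪gradient f (U * Vᵀ), u * vᵀ⟫_ℝ) := by
  have hgram : (u * eᵀ)ᵀ * (u * eᵀ) = (v * eᵀ)ᵀ * (v * eᵀ) := by
    simp only [Matrix.transpose_mul, Matrix.transpose_transpose, Matrix.mul_assoc]
    rw [← Matrix.mul_assoc uᵀ, ← Matrix.mul_assoc vᵀ, hu, hv]
  have hsecond : u * eᵀ * (v * eᵀ)ᵀ = u * vᵀ := by
    rw [Matrix.transpose_mul, Matrix.transpose_transpose, Matrix.mul_assoc,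
      ← Matrix.mul_assoc eᵀ, he, Matrix.one_mul]
  have hfirst : u * eᵀ * Vᵀ + U * (v * eᵀ)ᵀ = u * (V * e)ᵀ + U * e * vᵀ := by
    simp only [Matrix.transpose_mul, Matrix.transpose_transpose, Matrix.mul_assoc]
  have hrank : (u * (V * e)ᵀ + U * e * vᵀ).rank ≤ q := by
    have hleft : (u * (V * e)ᵀ).rank ≤ 1 := by simpa using rank_mul_le_card u (V * e)ᵀ
    have hright : (U * e * vᵀ).rank ≤ 1 := by simpa using rank_mul_le_card (U * e) vᵀ
    have hadd := rank_add_le (u * (V * e)ᵀ) (U * e * vᵀ)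
    omega
  have hnorm : ‖u * (V * e)ᵀ + U * e * vᵀ‖ ^ 2 = 2 * ‖V * e‖ ^ 2 := by
    have hVev : (V * e)ᵀ * v = 0 := by
      rw [Matrix.transpose_mul, Matrix.mul_assoc, hVv, Matrix.mul_zero]
    rw [norm_mul_transpose_add_sq hu hv hVev, norm_mul_eq_norm_mul hUV, two_mul]
  have hhess := hessForm_rho_fromRows hf μ (A := u * eᵀ) (B := v * eᵀ)
    (by rw [← Matrix.mul_assoc, hUu, Matrix.zero_mul])
    (by rw [← Matrix.mul_assoc, hVv, Matrix.zero_mul]) hgram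
  rw [hsecond, hfirst] at hhess
  have hsmooth := (h _ _ hp hrank).2
  rw [hnorm] at hsmooth
  rw [hhess]
  linarith

lemma lt_three_mul_of_div_lt (hα : 0 < α) (h : β / α < 1 + √2) : β < 3 * α := by
  have hsqrt : √2 < 2 := by rw [Real.sqrt_lt' two_pos]; norm_num
  rw [div_lt_iff₀ hα] at h
  nlinarith

lemma rate_pos (hα : 0 < α) (hle : α ≤ β) (h : β / α < 1 + √2) :
    0 < (α ^ 2 + 2 * α * β - β ^ 2) / (α + β) := by
  have hsqrt : √2 ^ 2 = 2 := Real.sq_sqrt zero_le_two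
  rw [div_lt_iff₀ hα] at h
  refine div_pos ?_ (by linarith)
  have hsq : (β - α) ^ 2 < (√2 * α) ^ 2 :=
    pow_lt_pow_left₀ (by linarith) (sub_nonneg.mpr hle) two_ne_zero
  rw [mul_pow, hsqrt] at hsq
  linarith

lemma mul_sq_sub_le (hα : 0 < α) (hle : α ≤ β) {σ s g : ℝ}
    (hrate : 0 ≤ (α ^ 2 + 2 * α * β - β ^ 2) / (α + β)) (hσ : α * σ ≤ g)
    (hs : α * (α + β) * s ^ 2 ≤ g * (β - α)) :
    β * s ^ 2 - g ≤ -((α ^ 2 + 2 * α * β - β ^ 2) / (α + β)) * σ := by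
  have hαβ : 0 < α + β := by linarith
  set c := (α ^ 2 + 2 * α * β - β ^ 2) / (α + β)
  have hc : c * (α + β) = α ^ 2 + 2 * α * β - β ^ 2 := div_mul_cancel₀ _ hαβ.ne'
  refine le_of_mul_le_mul_left ?_ (mul_pos hα hαβ)
  calc α * (α + β) * (β * s ^ 2 - g) = β * (α * (α + β) * s ^ 2) - α * (α + β) * g := by ring
    _ ≤ β * (g * (β - α)) - α * (α + β) * g := by
        gcongr
        linarith
    _ = -((α + β) * c * g) := by linear_combination g * hc
    _ ≤ -((α + β) * c * (α * σ)) := by gcongr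
    _ = α * (α + β) * (-c * σ) := by ring

lemma mul_norm_sq_sub_le_neg_inner_gradient (hf : ContDiff ℝ 2 f)
    (h : RestrictedConvexSmooth p q α β f) {Xs : Matrix (Fin n) (Fin m) ℝ} (hXs : IsCritical f Xs)
    (hUV : IsBalancedCritical f U V) (hp : Xs.rank + (U * Vᵀ).rank ≤ p)
    (hq : Xs.rank + (U * Vᵀ).rank ≤ q) :
    α * ‖U * Vᵀ - Xs‖ ^ 2 ≤ -⟪gradient f (U * Vᵀ), Xs⟫_ℝ := by
  have hzero : ⟪gradient f (U * Vᵀ), U * Vᵀ⟫_ℝ = 0 := by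
    rw [real_inner_comm, inner_mul_right, Matrix.transpose_transpose, hUV.gradient_mul,
      inner_zero_right]
  have hle := mul_norm_sq_sub_le_inner_gradient hf h hXs hp hq
  rwa [inner_sub_right, hzero, zero_sub] at hle

variable {Xs : Matrix (Fin n) (Fin m) ℝ}

lemma neg_inner_gradient_pos (hf : ContDiff ℝ 2 f) (hα : 0 < α)
    (h : RestrictedConvexSmooth p q α β f) (hXs : IsCritical f Xs)
    (hUV : IsBalancedCritical f U V) (hp : Xs.rank + (U * Vᵀ).rank ≤ p)
    (hq : Xs.rank + (U * Vᵀ).rank ≤ q) (hne : U * Vᵀ ≠ Xs) :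
    0 < -⟪gradient f (U * Vᵀ), Xs⟫_ℝ := by
  have hdist : 0 < ‖U * Vᵀ - Xs‖ := norm_pos_iff.mpr (sub_ne_zero.mpr hne)
  exact lt_of_lt_of_le (by positivity)
    (mul_norm_sq_sub_le_neg_inner_gradient hf h hXs hUV hp hq)

lemma mul_sigma_rank_le (hf : ContDiff ℝ 2 f) (h : RestrictedConvexSmooth p q α β f)
    (hXs : IsCritical f Xs) (hUV : IsBalancedCritical f U V)
    (hp : Xs.rank + (U * Vᵀ).rank ≤ p) (hq : Xs.rank + (U * Vᵀ).rank ≤ q)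
    (hne : U * Vᵀ ≠ Xs) {g : ℝ} (hg : 0 ≤ g)
    (hG : ∀ Z : Matrix (Fin m) (Fin m) ℝ, ‖gradient f (U * Vᵀ) * Z‖ ≤ g * ‖Z‖) :
    α * sigma Xs.rank Xs ≤ g := by
  have hdist : 0 < ‖U * Vᵀ - Xs‖ := norm_pos_iff.mpr (sub_ne_zero.mpr hne)
  have hleft : (U * Vᵀ)ᵀ * gradient f (U * Vᵀ) = 0 := by
    rw [Matrix.transpose_mul, Matrix.mul_assoc, hUV.transpose_mul_gradient, Matrix.mul_zero]
  have hright : gradient f (U * Vᵀ) * (U * Vᵀ)ᵀ = 0 := by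
    rw [Matrix.transpose_mul, Matrix.transpose_transpose, ← Matrix.mul_assoc, hUV.gradient_mul,
      Matrix.zero_mul]
  refine le_of_mul_le_mul_right ?_ (sq_pos_of_pos hdist)
  calc α * sigma Xs.rank Xs * ‖U * Vᵀ - Xs‖ ^ 2
      = sigma Xs.rank Xs * (α * ‖U * Vᵀ - Xs‖ ^ 2) := by ring
    _ ≤ sigma Xs.rank Xs * -⟪gradient f (U * Vᵀ), Xs⟫_ℝ :=
        mul_le_mul_of_nonneg_left (mul_norm_sq_sub_le_neg_inner_gradient hf h hXs hUV hp hq)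
          (sigma_nonneg _ _)
    _ ≤ g * ‖U * Vᵀ - Xs‖ ^ 2 := sigma_mul_neg_inner_le hleft hright hG hg

lemma mul_eq_zero_of_mul_eq_smul {R l η : Type*} [Field R] {B : Matrix l ι R} {G : Matrix ι κ R}
    {u : Matrix ι η R} {v : Matrix κ η R} {s : R} (hs : s ≠ 0) (hBG : B * G = 0)
    (hGv : G * v = s • u) : B * u = 0 := by
  refine (smul_eq_zero_iff_right hs).mp ?_
  rw [← Matrix.mul_smul, ← hGv, ← Matrix.mul_assoc, hBG, Matrix.zero_mul]

lemma exists_hessForm_rho_fromRows_le (hf : ContDiff ℝ 2 f)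
    (h : RestrictedConvexSmooth p q α β f) (μ : ℝ) (hp : (U * Vᵀ).rank ≤ p) (hq : 2 ≤ q)
    (hUV : IsBalancedCritical f U V) {g : ℝ} (hg : g ≠ 0) {u : Matrix (Fin n) Unit ℝ}
    {v : Matrix (Fin m) Unit ℝ} {e : Matrix (Fin r) Unit ℝ} (hu : ‖u‖ = 1) (hv : ‖v‖ = 1)
    (he : ‖e‖ = 1) (hGv : gradient f (U * Vᵀ) * v = g • u)
    (hGu : (gradient f (U * Vᵀ))ᵀ * u = g • v) :
    ∃ D, ‖D‖ ^ 2 = 2 ∧ hessForm (rho f μ) (Matrix.fromRows U V) D D ≤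
      2 * (β * ‖V * e‖ ^ 2 - g) := by
  have hnu : ‖-u‖ = 1 := (norm_neg u).trans hu
  have heT := transpose_mul_self_eq_one he
  have hinner : ⟪gradient f (U * Vᵀ), -u * vᵀ⟫_ℝ = -g := by
    rw [real_inner_comm, inner_mul_right, Matrix.transpose_transpose, hGv, inner_neg_left,
      real_inner_smul_right, real_inner_self_eq_norm_sq, hu, one_pow, mul_one]
  have hUu : Uᵀ * -u = 0 := by
    rw [Matrix.mul_neg, mul_eq_zero_of_mul_eq_smul hg hUV.transpose_mul_gradient hGv, neg_zero]
  have hVG : Vᵀ * (gradient f (U * Vᵀ))ᵀ = 0 := by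
    rw [← Matrix.transpose_mul, hUV.gradient_mul, Matrix.transpose_zero]
  refine ⟨Matrix.fromRows (-u * eᵀ) (v * eᵀ), ?_, ?_⟩
  · rw [norm_fromRows_sq, norm_mul_transpose heT, norm_mul_transpose heT, hnu, hv]
    norm_num
  · rw [sub_eq_add_neg, ← hinner]
    exact hessForm_rho_fromRows_mul_transpose_le hf h μ hp hq hUV.transpose_mul_self_eq
      (transpose_mul_self_eq_one hnu) (transpose_mul_self_eq_one hv) heT hUu
      (mul_eq_zero_of_mul_eq_smul hg hVG hGu)

lemma exists_hessForm_rho_le (hf : ContDiff ℝ 2 f) (hα : 0 < α)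
    (h : RestrictedConvexSmooth (2 * r) (4 * r) α β f) (hβ : β / α < 1 + √2) (μ : ℝ)
    (hXs : IsCritical f Xs) (hrank : Xs.rank ≤ r) (hUV : IsBalancedCritical f U V)
    (hne : U * Vᵀ ≠ Xs) :
    ∃ D, ‖D‖ ^ 2 = 2 ∧ hessForm (rho f μ) (Matrix.fromRows U V) D D < 0 ∧
      hessForm (rho f μ) (Matrix.fromRows U V) D D ≤
        2 * (-((α ^ 2 + 2 * α * β - β ^ 2) / (α + β)) * sigma Xs.rank Xs) := by
  have hX : (U * Vᵀ).rank ≤ r := by simpa using rank_mul_le_card U Vᵀ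
  have hinner := neg_inner_gradient_pos hf hα h hXs hUV (by omega) (by omega) hne
  have hXs0 : Xs ≠ 0 := by
    rintro rfl
    simp at hinner
  have hG0 : gradient f (U * Vᵀ) ≠ 0 := by
    intro hzero
    simp [hzero] at hinner
  have hle : α ≤ β := sub_nonneg.mp
    (nonneg_of_mul_nonneg_left (sub_mul_norm_nonneg h (by omega))
      (norm_pos_iff.mpr hXs0))
  have hr : 0 < r := (rank_pos hXs0).trans_le hrank
  have : Nonempty (Fin r) := Fin.pos_iff_nonempty.mp hr
  obtain ⟨g, u, v, hg, hu, hv, hGv, hGu, hG⟩ := exists_greatestSingularVectors hG0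
  obtain ⟨e, he, hV⟩ := exists_leastSingularVector V
  obtain ⟨D, hD, hhess⟩ := exists_hessForm_rho_fromRows_le hf h μ (by omega) (by omega) hUV hg.ne'
    hu hv he hGv hGu
  have hs := mul_add_mul_sq_le_mul_sub hf h hα hle (lt_three_mul_of_div_lt hα hβ) hXs hrank hUV
    hne (norm_nonneg _) hg.le hV hG
  have hσ := mul_sigma_rank_le hf h hXs hUV (by omega) (by omega) hne hg.le hG
  have hrate := rate_pos hα hle hβ
  have hbound := mul_sq_sub_le hα hle hrate.le hσ hs
  have hpos := mul_pos hrate (sigma_rank_pos (rank_pos hXs0))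
  exact ⟨D, hD, by linarith, by linarith⟩

lemma mul_transpose_eq_of_isLocalMin (hf : ContDiff ℝ 2 f) (hα : 0 < α)
    (h : RestrictedConvexSmooth (2 * r) (4 * r) α β f) (hβ : β / α < 1 + √2)
    (hXs : IsCritical f Xs) (hrank : Xs.rank ≤ r) (hUV : IsBalancedCritical f U V)
    (hmin : IsLocalMin (rho f μ) (Matrix.fromRows U V)) : U * Vᵀ = Xs := by
  by_contra hne
  obtain ⟨D, -, hneg, -⟩ := exists_hessForm_rho_le hf hα h hβ μ hXs hrank hUV hne
  exact hneg.not_ge (hessForm_nonneg_of_isLocalMin (contDiff_rho hf μ) hmin D)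

lemma lambdaMin_hessMatrix_rho_le (hf : ContDiff ℝ 2 f) (hα : 0 < α)
    (h : RestrictedConvexSmooth (2 * r) (4 * r) α β f) (hβ : β / α < 1 + √2) (μ : ℝ)
    (hXs : IsCritical f Xs) (hrank : Xs.rank ≤ r) (hUV : IsBalancedCritical f U V)
    (hne : U * Vᵀ ≠ Xs) :
    lambdaMin (hessMatrix (rho f μ) (Matrix.fromRows U V)) < 0 ∧
      lambdaMin (hessMatrix (rho f μ) (Matrix.fromRows U V)) ≤
        -((α ^ 2 + 2 * α * β - β ^ 2) / (α + β)) * sigma Xs.rank Xs := by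
  obtain ⟨D, hD, hneg, hle⟩ := exists_hessForm_rho_le hf hα h hβ μ hXs hrank hUV hne
  have hmin := lambdaMin_hessMatrix_mul_norm_sq_le (contDiff_rho hf μ) (Matrix.fromRows U V) D
  rw [hD] at hmin
  constructor <;> linarith

lemma rho_fromRows_le_of_isLowRankSolution (hμ : 0 ≤ μ) (hUV : Uᵀ * U = Vᵀ * V)
    (h : IsLowRankSolution f r (U * Vᵀ)) (W : Matrix (Fin n ⊕ Fin m) (Fin r) ℝ) :
    rho f μ (Matrix.fromRows U V) ≤ rho f μ W := by
  have hrank : (W.toRows₁ * W.toRows₂ᵀ).rank ≤ r := by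
    simpa using rank_mul_le_card W.toRows₁ W.toRows₂ᵀ
  calc rho f μ (Matrix.fromRows U V) = f (U * Vᵀ) := by simp [rho, hUV]
    _ ≤ f (W.toRows₁ * W.toRows₂ᵀ) := h.2 _ hrank
    _ ≤ rho f μ W := le_add_of_nonneg_right (by positivity)

lemma seven_tenths_mul_le_rate (hα : 0 < α) (hβ : 0 < β) (h : β / α ≤ 1.5) :
    0.7 * α ≤ (α ^ 2 + 2 * α * β - β ^ 2) / (α + β) := by
  rw [div_le_iff₀ hα] at h
  rw [le_div_iff₀ (add_pos hα hβ)]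
  have hfactor : 0 ≤ (1.5 * α - β) * (β + 0.2 * α) :=
    mul_nonneg (sub_nonneg.mpr h) (by positivity)
  linarith

lemma le_neg_mul_mul_of_le_neg_rate_mul (hα : 0 < α) (hβ : 0 < β) (h : β / α ≤ 1.5)
    {c σ y : ℝ} (hc : c ≤ 0.7) (hσ : 0 ≤ σ)
    (hy : y ≤ -((α ^ 2 + 2 * α * β - β ^ 2) / (α + β)) * σ) : y ≤ -c * α * σ := by
  have hrate : c * α ≤ (α ^ 2 + 2 * α * β - β ^ 2) / (α + β) :=
    (mul_le_mul_of_nonneg_right hc hα.le).trans (seven_tenths_mul_le_rate hα hβ h)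
  linarith [mul_le_mul_of_nonneg_right hrate hσ]

lemma le_of_le_neg_rate_mul (hα : 0 < α) (hβ : 0 < β) (h : β / α ≤ 1.5) {σ τ y : ℝ} (hσ : 0 ≤ σ)
    (hy : y ≤ -((α ^ 2 + 2 * α * β - β ^ 2) / (α + β)) * σ) :
    y ≤ -0.08 * α * σ ∧ y ≤ -0.05 * α * min τ (2 * σ) ∧ y ≤ -0.1 * α * σ := by
  have hrate {c : ℝ} (hc : c ≤ 0.7) := le_neg_mul_mul_of_le_neg_rate_mul hα hβ h hc hσ hy
  refine ⟨hrate (by norm_num), ?_, hrate (by norm_num)⟩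
  calc y ≤ -0.1 * α * σ := hrate (by norm_num)
    _ = -0.05 * α * (2 * σ) := by ring
    _ ≤ -0.05 * α * min τ (2 * σ) :=
        mul_le_mul_of_nonpos_left (min_le_right _ _) (by linarith)

end NegativeCurvature

end LowRankOpt

open LowRankOpt in
theorem theorem3_general {n m r : ℕ} (f : Matrix (Fin n) (Fin m) ℝ → ℝ) (hf : ContDiff ℝ 2 f)
    (μ : ℝ) (hμ : 0 < μ) :
    (∀ (U : Matrix (Fin n) (Fin r) ℝ) (V : Matrix (Fin m) (Fin r) ℝ),
      IsCritical (rho f μ) (Matrix.fromRows U V) → Uᵀ * U - Vᵀ * V = 0) ∧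
    ∀ α β : ℝ, 0 < α → RestrictedConvexSmooth (2 * r) (4 * r) α β f → β / α < 1 + √2 →
      ∀ (Xs : Matrix (Fin n) (Fin m) ℝ) (rs : ℕ), IsCritical f Xs → Xs.rank = rs → rs ≤ r →
        (∀ X, IsLowRankSolution f r X ↔ X = Xs) ∧
        (∀ (U : Matrix (Fin n) (Fin r) ℝ) (V : Matrix (Fin m) (Fin r) ℝ),
          IsLocalMin (rho f μ) (Matrix.fromRows U V) →
            (∀ W : Matrix (Fin n ⊕ Fin m) (Fin r) ℝ, rho f μ (Matrix.fromRows U V) ≤ rho f μ W) ∧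
            U * Vᵀ = Xs) ∧
        (∀ W : Matrix (Fin n ⊕ Fin m) (Fin r) ℝ,
          IsCritical (rho f μ) W → ¬ IsLocalMin (rho f μ) W →
            lambdaMin (hessMatrix (rho f μ) W) < 0 ∧
            lambdaMin (hessMatrix (rho f μ) W) ≤
              -((α ^ 2 + 2 * α * β - β ^ 2) / (α + β)) * sigma rs Xs) := by
  have hf1 : ContDiff ℝ 1 f := hf.of_le one_le_two
  refine ⟨fun U V => transpose_mul_self_sub_eq_zero_of_isCritical hf1 hμ, ?_⟩
  rintro α β hα h hβ Xs rs hXs rfl hrank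
  have hsol (X) : IsLowRankSolution f r X ↔ X = Xs :=
    isLowRankSolution_iff_eq hf hα h le_rfl (by omega) hXs hrank
  have hglobal {U : Matrix (Fin n) (Fin r) ℝ} {V : Matrix (Fin m) (Fin r) ℝ}
      (hUV : IsBalancedCritical f U V) (heq : U * Vᵀ = Xs) :=
    rho_fromRows_le_of_isLowRankSolution hμ.le hUV.transpose_mul_self_eq ((hsol _).mpr heq)
  refine ⟨hsol, fun U V hmin => ?_, fun W hcrit hnot => ?_⟩
  · have hUV := isBalancedCritical_of_isCritical hf1 hμ hmin.fderiv_eq_zero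
    have heq := mul_transpose_eq_of_isLocalMin hf hα h hβ hXs hrank hUV hmin
    exact ⟨hglobal hUV heq, heq⟩
  · rw [← W.fromRows_toRows] at hcrit hnot ⊢
    have hUV := isBalancedCritical_of_isCritical hf1 hμ hcrit
    exact lambdaMin_hessMatrix_rho_le hf hα h hβ μ hXs hrank hUV fun heq =>
      hnot (Filter.Eventually.of_forall (hglobal hUV heq))

theorem theorem3 {n m r : ℕ} (f : Matrix (Fin n) (Fin m) ℝ → ℝ) (hf : ContDiff ℝ 2 f)
    (μ : ℝ) (hμ : 0 < μ) :
    (∀ (U : Matrix (Fin n) (Fin r) ℝ) (V : Matrix (Fin m) (Fin r) ℝ),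
      LowRankOpt.IsCritical (LowRankOpt.rho f μ) (Matrix.fromRows U V) →
        Uᵀ * U - Vᵀ * V = 0) ∧
    ∀ (α β : ℝ), 0 < α → 0 < β →
      LowRankOpt.RestrictedConvexSmooth (2 * r) (4 * r) α β f → β / α ≤ 1.5 →
      ∀ (Xs : Matrix (Fin n) (Fin m) ℝ) (rs : ℕ), LowRankOpt.IsCritical f Xs →
        Xs.rank = rs → rs ≤ r → μ ≤ α / 16 →
        -- `Xs` is the unique solution of the rank-constrained problem
        (∀ X, LowRankOpt.IsLowRankSolution f r X ↔ X = Xs) ∧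
        -- no spurious local minima
        (∀ (U : Matrix (Fin n) (Fin r) ℝ) (V : Matrix (Fin m) (Fin r) ℝ),
          IsLocalMin (LowRankOpt.rho f μ) (Matrix.fromRows U V) →
            (∀ W : Matrix (Fin n ⊕ Fin m) (Fin r) ℝ,
              LowRankOpt.rho f μ (Matrix.fromRows U V) ≤ LowRankOpt.rho f μ W) ∧
            U * Vᵀ = Xs) ∧
        -- every other critical point is a strict saddle, with explicit bounds
        (∀ W : Matrix (Fin n ⊕ Fin m) (Fin r) ℝ,
          LowRankOpt.IsCritical (LowRankOpt.rho f μ) W →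
          ¬ IsLocalMin (LowRankOpt.rho f μ) W →
            LowRankOpt.lambdaMin (LowRankOpt.hessMatrix (LowRankOpt.rho f μ) W) < 0 ∧
            (r = rs →
              LowRankOpt.lambdaMin (LowRankOpt.hessMatrix (LowRankOpt.rho f μ) W)
                ≤ -0.08 * α * LowRankOpt.sigma r Xs) ∧
            (rs < r → 0 < W.rank →
              LowRankOpt.lambdaMin (LowRankOpt.hessMatrix (LowRankOpt.rho f μ) W)
                ≤ -0.05 * α *
                  min (LowRankOpt.sigma W.rank W ^ 2) (2 * LowRankOpt.sigma rs Xs)) ∧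
            (W.rank = 0 →
              LowRankOpt.lambdaMin (LowRankOpt.hessMatrix (LowRankOpt.rho f μ) W)
                ≤ -0.1 * α * LowRankOpt.sigma rs Xs)) := by
  have hsqrt : 1.5 < 1 + √2 := by linarith [Real.one_lt_sqrt_two]
  refine (theorem3_general f hf μ hμ).imp_right
    fun hgeneral α β hα hβ h hβα Xs rs hXs hrs hr _ => ?_
  obtain ⟨hsol, hmin, hsaddle⟩ := hgeneral α β hα h (hβα.trans_lt hsqrt) Xs rs hXs hrs hr
  refine ⟨hsol, hmin, fun W hcrit hnot => ?_⟩
  obtain ⟨hneg, hle⟩ := hsaddle W hcrit hnot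
  obtain ⟨hexact, hover, hzero⟩ :=
    LowRankOpt.le_of_le_neg_rate_mul hα hβ hβα (LowRankOpt.sigma_nonneg rs Xs) hle
  exact ⟨hneg, fun hrrs => hrrs ▸ hexact, fun _ _ => hover, fun _ => hzero⟩
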